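/- Let $\Omega\subset\mathbb{R}^n$ be open, and let $p:\Omega\to\mathbb{R}$ be Lipschitz continuous with $1<p^-\le p(x)\le p^+<\infty$ for all $x\in\Omega$; put $p'(x)=p(x)/(p(x)-1)$. Let $L^{p(\cdot)}(\Omega)$ and $W^{1,p(\cdot)}(\Omega)$ be the variable exponent Lebesgue and Sobolev spaces with the Luxemburg norm $\|f\|_{p(\cdot)}=\inf\{t>0:\int_\Omega |f(x)/t|^{p(x)}\,dx\le 1\}$ and the norm $\|u\|_{p(\cdot)}+\|\nabla u\|_{p(\cdot)}$ ($\nabla u$ the weak gradient), and let $W^{1,p(\cdot)}_0(\Omega)$ be the closure of $C_c^\infty(\Omega)$ in $W^{1,p(\cdot)}(\Omega)$. Let $a<0$ be a constant, let $f,f'\in L^{p'(\cdot)}(\Omega)$ satisfy $f\le f'$ a.e. in $\Omega$, and let $g,g'\in W^{1,p(\cdot)}(\Omega)$ satisfy $g\le g'$ on $\partial\Omega$ in the sense that $(g-g')^+=\max\{g-g',0\}\in W^{1,p(\cdot)}_0(\Omega)$ (for example, $g\le g'$ a.e. in $\Omega$). Assume that $u,v\in W^{1,p(\cdot)}(\Omega)$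 are weak solutions of $$-\Delta_{p(\cdot)}u=a|u|^{p(x)-2}u+f \ \text{ in }\Omega,\quad u=g\ \text{ on }\partial\Omega,$$ $$-\Delta_{p(\cdot)}v=a|v|^{p(x)-2}v+f' \ \text{ in }\Omega,\quad v=g'\ \text{ on }\partial\Omega,$$ that is, $u-g\in W^{1,p(\cdot)}_0(\Omega)$ and $$\int_\Omega |\nabla u|^{p(x)-2}\langle\nabla u,\nabla\psi\rangle\,dx=a\int_\Omega|u|^{p(x)-2}u\,\psi\,dx+\int_\Omega f\psi\,dx\qquad\text{for all }\psi\in W^{1,p(\cdot)}_0(\Omega),$$ and likewise for $v$ with $f',g'$ in place of $f,g$. Then $u\le v$ a.e. in $\Omega$. -/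

import Mathlib

open MeasureTheory Set
open scoped ENNReal ContDiff

noncomputable section

/-- The modular `∫_Ω |f(x)|^{p(x)} dx` of a scalar or vector valued function. -/
def modular {n : ℕ} {F : Type*} [NormedAddCommGroup F] (p : EuclideanSpace ℝ (Fin n) → ℝ)
    (Ω : Set (EuclideanSpace ℝ (Fin n))) (f : EuclideanSpace ℝ (Fin n) → F) : ℝ≥0∞ :=
  ∫⁻ x in Ω, ENNReal.ofReal (‖f x‖ ^ p x)

/-- The Luxemburg norm `inf {t > 0 : ∫_Ω |f(x)/t|^{p(x)} dx ≤ 1}`, with value `∞` if there is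
no such `t`. -/
def luxNorm {n : ℕ} {F : Type*} [NormedAddCommGroup F] [NormedSpace ℝ F]
    (p : EuclideanSpace ℝ (Fin n) → ℝ)
    (Ω : Set (EuclideanSpace ℝ (Fin n))) (f : EuclideanSpace ℝ (Fin n) → F) : ℝ≥0∞ :=
  ⨅ (t : ℝ) (_ : 0 < t ∧ modular p Ω (fun x => t⁻¹ • f x) ≤ 1), ENNReal.ofReal t

/-- `f ∈ L^{p(·)}(Ω)`. -/
def MemLpVar {n : ℕ} {F : Type*} [NormedAddCommGroup F] [NormedSpace ℝ F]
    (p : EuclideanSpace ℝ (Fin n) → ℝ)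
    (Ω : Set (EuclideanSpace ℝ (Fin n))) (f : EuclideanSpace ℝ (Fin n) → F) : Prop :=
  AEStronglyMeasurable f (volume.restrict Ω) ∧ luxNorm p Ω f < ⊤

/-- `φ ∈ C_c^∞(Ω)`. -/
def IsTestFunction {n : ℕ} (Ω : Set (EuclideanSpace ℝ (Fin n)))
    (φ : EuclideanSpace ℝ (Fin n) → ℝ) : Prop :=
  ContDiff ℝ ∞ φ ∧ HasCompactSupport φ ∧ tsupport φ ⊆ Ω

/-- `G` is the weak (distributional) gradient of `u` in `Ω`; it is unique up to null sets. -/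
def HasWeakGradient {n : ℕ} (Ω : Set (EuclideanSpace ℝ (Fin n)))
    (u : EuclideanSpace ℝ (Fin n) → ℝ)
    (G : EuclideanSpace ℝ (Fin n) → EuclideanSpace ℝ (Fin n)) : Prop :=
  LocallyIntegrableOn u Ω ∧ LocallyIntegrableOn G Ω ∧
    ∀ φ, IsTestFunction Ω φ → ∀ e : EuclideanSpace ℝ (Fin n),
      ∫ x in Ω, u x * fderiv ℝ φ x e = -∫ x in Ω, φ x * inner ℝ (G x) e

/-- `u ∈ W^{1,p(·)}(Ω)`. -/
def MemSobolev {n : ℕ} (p : EuclideanSpace ℝ (Fin n) → ℝ)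
    (Ω : Set (EuclideanSpace ℝ (Fin n))) (u : EuclideanSpace ℝ (Fin n) → ℝ) : Prop :=
  MemLpVar p Ω u ∧ ∃ G, HasWeakGradient Ω u G ∧ MemLpVar p Ω G

/-- `u ∈ W_0^{1,p(·)}(Ω)`, the closure of `C_c^∞(Ω)` in `W^{1,p(·)}(Ω)` with respect to the norm
`‖u‖_{p(·)} + ‖∇u‖_{p(·)}`. -/
def MemSobolevZero {n : ℕ} (p : EuclideanSpace ℝ (Fin n) → ℝ)
    (Ω : Set (EuclideanSpace ℝ (Fin n))) (u : EuclideanSpace ℝ (Fin n) → ℝ) : Prop :=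
  MemLpVar p Ω u ∧ ∃ G, HasWeakGradient Ω u G ∧ MemLpVar p Ω G ∧
    ∀ ε : ℝ≥0∞, 0 < ε → ∃ φ, IsTestFunction Ω φ ∧
      luxNorm p Ω (fun x => u x - φ x) + luxNorm p Ω (fun x => G x - gradient φ x) < ε

/-- `u ∈ W^{1,p(·)}(Ω)` is a weak solution of
`-div(|∇u|^{p(x)-2} ∇u) = a |u|^{p(x)-2} u + f` in `Ω`, tested against `W_0^{1,p(·)}(Ω)`. -/
def IsWeakSolution {n : ℕ} (p : EuclideanSpace ℝ (Fin n) → ℝ)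
    (Ω : Set (EuclideanSpace ℝ (Fin n))) (a : ℝ) (f u : EuclideanSpace ℝ (Fin n) → ℝ) : Prop :=
  MemSobolev p Ω u ∧
    ∀ G, HasWeakGradient Ω u G →
      ∀ ψ H, MemSobolevZero p Ω ψ → HasWeakGradient Ω ψ H →
        ∫ x in Ω, ‖G x‖ ^ (p x - 2) * inner ℝ (G x) (H x)
          = a * (∫ x in Ω, |u x| ^ (p x - 2) * u x * ψ x) + ∫ x in Ω, f x * ψ x

/-- `u = g` on `∂Ω` in the Sobolev sense. -/
def EqOnBoundary {n : ℕ} (p : EuclideanSpace ℝ (Fin n) → ℝ)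
    (Ω : Set (EuclideanSpace ℝ (Fin n))) (u g : EuclideanSpace ℝ (Fin n) → ℝ) : Prop :=
  MemSobolevZero p Ω (fun x => u x - g x)

/-- `g ≤ h` on `∂Ω` in the Sobolev sense: `(g - h)^+ ∈ W_0^{1,p(·)}(Ω)`. This holds in particular
if `g ≤ h` a.e. in `Ω`, see `leOnBoundary_of_ae_le`. -/
def LeOnBoundary {n : ℕ} (p : EuclideanSpace ℝ (Fin n) → ℝ)
    (Ω : Set (EuclideanSpace ℝ (Fin n))) (g h : EuclideanSpace ℝ (Fin n) → ℝ) : Prop :=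
  MemSobolevZero p Ω (fun x => max (g x - h x) 0)

theorem luxNorm_eq_zero_of_ae {n : ℕ} {F : Type*} [NormedAddCommGroup F] [NormedSpace ℝ F]
    {p : EuclideanSpace ℝ (Fin n) → ℝ} {Ω : Set (EuclideanSpace ℝ (Fin n))} (hΩ : IsOpen Ω)
    (hp : ∀ x ∈ Ω, 0 < p x) {f : EuclideanSpace ℝ (Fin n) → F}
    (hf : ∀ᵐ x ∂(volume.restrict Ω), f x = 0) : luxNorm p Ω f = 0 := by
  have key : ∀ t : ℝ, modular p Ω (fun x => t⁻¹ • f x) = 0 := by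
    intro t
    unfold modular
    rw [← lintegral_zero (μ := volume.restrict Ω)]
    apply lintegral_congr_ae
    filter_upwards [hf, ae_restrict_mem hΩ.measurableSet] with x hx hxΩ
    simp [hx, Real.zero_rpow (hp x hxΩ).ne']
  refine le_antisymm (ENNReal.le_of_forall_pos_le_add ?_) bot_le
  intro ε hε _
  refine (iInf₂_le (ε : ℝ) ⟨by exact_mod_cast hε, by rw [key]; exact zero_le_one⟩).trans ?_
  simp

theorem leOnBoundary_of_ae_le {n : ℕ} {p : EuclideanSpace ℝ (Fin n) → ℝ}
    {Ω : Set (EuclideanSpace ℝ (Fin n))} (hΩ : IsOpen Ω) (hp : ∀ x ∈ Ω, 0 < p x)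
    {g h : EuclideanSpace ℝ (Fin n) → ℝ} (hgh : ∀ᵐ x ∂(volume.restrict Ω), g x ≤ h x) :
    LeOnBoundary p Ω g h := by
  have h0 : ∀ᵐ x ∂(volume.restrict Ω), max (g x - h x) 0 = 0 := by
    filter_upwards [hgh] with x hx
    simpa using hx
  have hm : (fun x => max (g x - h x) 0) =ᵐ[volume.restrict Ω] fun _ => (0 : ℝ) := h0
  have hz : luxNorm p Ω (fun _ => (0 : EuclideanSpace ℝ (Fin n))) = 0 :=
    luxNorm_eq_zero_of_ae hΩ hp (by simp)
  refine ⟨⟨aestronglyMeasurable_const.congr hm.symm, ?_⟩, fun _ => 0, ⟨?_, ?_, ?_⟩, ⟨?_, ?_⟩, ?_⟩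
  · rw [luxNorm_eq_zero_of_ae hΩ hp h0]; simp
  · exact IntegrableOn.locallyIntegrableOn ((integrable_zero _ _ _).congr hm.symm)
  · exact (locallyIntegrable_const 0).locallyIntegrableOn _
  · intro φ _ e
    rw [integral_eq_zero_of_ae]
    · simp
    · filter_upwards [h0] with x hx
      simp [hx]
  · exact aestronglyMeasurable_const
  · rw [hz]; simp
  · intro ε hε
    refine ⟨fun _ => 0, ⟨contDiff_const, HasCompactSupport.zero, by simp [tsupport]⟩, ?_⟩
    have h1 : luxNorm p Ω (fun x => max (g x - h x) 0 - 0) = 0 :=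
      luxNorm_eq_zero_of_ae hΩ hp (by simpa using h0)
    have h2 : luxNorm p Ω (fun x => (0 : EuclideanSpace ℝ (Fin n)) -
        gradient (fun _ : EuclideanSpace ℝ (Fin n) => (0 : ℝ)) x) = 0 :=
      luxNorm_eq_zero_of_ae hΩ hp (by simp [gradient])
    rw [h1, h2]
    simpa using hε

end

open Filter Topology
open scoped Convolution

-- Both equations are tested with `w = (u - v)⁺` and subtracted. The gradient of `w` is `∇u - ∇v`
-- where `u > v` and zero elsewhere, so monotonicity of `ξ ↦ |ξ|^{r-2} ξ`
-- (`norm_rpow_mul_inner_sub_le`) makes the difference of the left sides nonnegative, while the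
-- contribution of `f - f'` is nonpositive. As `a < 0`, the integral of `(|u|^{p-2} u - |v|^{p-2} v)
-- w` is at most zero. Its integrand is nonnegative, hence zero a.e., and strict monotonicity of `t
-- ↦ |t|^{r-2} t` rules out `u > v` on a set of positive measure.
--
-- The work lies in showing `w ∈ W_0^{1,p(·)}`. The boundary conditions give `s ≤ k` for `s = u - v`
-- and `k = (u - g) - (v - g') + (g - g')⁺`, where `k` is a limit of test functions `φ_j`. The
-- functions `(φ_j - (k - s))⁺` vanish outside the support of `φ_j` and converge to `s⁺`
-- (`ModularApprox.posPart_of_le`); being compactly supported, they are limits of their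
-- mollifications (`modularApprox_of_isCompact`).
--
-- Two tools support this. Mollification is controlled for a variable exponent because a Lipschitz
-- `p` varies by at most `L / N` on a ball of radius `1 / N`, and `N ^ (n L / N)` is bounded
-- (`exists_norm_mollify_rpow_le`). The chain rule for the positive part (`HasWeakGradient.posPart`)
-- gives the gradient of `w`, and also that a weak gradient vanishes a.e. on the zero set of its
-- function. Since the exponent is bounded, convergence is measured by the modular and translated to
-- the Luxemburg norm only at the ends.

local notation "𝔼" n:max => EuclideanSpace ℝ (Fin n)

/-! ### The modular and its relation to the Luxemburg norm. -/

section Modular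

variable {n : ℕ} {F : Type*} [NormedAddCommGroup F] {p : 𝔼 n → ℝ} {Ω : Set (𝔼 n)} {pp : ℝ}

theorem modular_mono (hΩ : MeasurableSet Ω) {H : Type*} [NormedAddCommGroup H] {f : 𝔼 n → F}
    {g : 𝔼 n → H} (hp : ∀ x ∈ Ω, 0 ≤ p x) (h : ∀ x ∈ Ω, ‖f x‖ ≤ ‖g x‖) :
    modular p Ω f ≤ modular p Ω g := by
  refine setLIntegral_mono' hΩ fun x hx => ?_
  exact ENNReal.ofReal_le_ofReal (Real.rpow_le_rpow (norm_nonneg _) (h x hx) (hp x hx))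

theorem aemeasurable_ofReal_norm_rpow (hΩ : MeasurableSet Ω) (hp : ContinuousOn p Ω)
    {f : 𝔼 n → F} (hf : AEStronglyMeasurable f (volume.restrict Ω)) :
    AEMeasurable (fun x => ENNReal.ofReal (‖f x‖ ^ p x)) (volume.restrict Ω) :=
  (hf.norm.aemeasurable.pow (hp.aemeasurable hΩ)).ennreal_ofReal

theorem integrableOn_norm_rpow (hΩ : MeasurableSet Ω) (hp : ContinuousOn p Ω)
    {f : 𝔼 n → F} (hf : AEStronglyMeasurable f (volume.restrict Ω)) (hm : modular p Ω f < ⊤) :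
    IntegrableOn (fun x => ‖f x‖ ^ p x) Ω := by
  refine ⟨(hf.norm.aemeasurable.pow (hp.aemeasurable hΩ)).aestronglyMeasurable, ?_⟩
  rw [hasFiniteIntegral_iff_ofReal (Eventually.of_forall fun x => by positivity)]
  exact hm

theorem add_rpow_le_two_rpow_mul {a b r s : ℝ} (ha : 0 ≤ a) (hb : 0 ≤ b) (hr : 0 ≤ r)
    (hrs : r ≤ s) : (a + b) ^ r ≤ 2 ^ s * (a ^ r + b ^ r) := by
  have hm : 0 ≤ max a b := le_max_of_le_left ha
  have h1 : (a + b) ^ r ≤ (2 * max a b) ^ r :=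
    Real.rpow_le_rpow (by positivity) (by linarith [le_max_left a b, le_max_right a b]) hr
  have h2 : (max a b) ^ r ≤ a ^ r + b ^ r := by
    rcases max_cases a b with h | h <;> rw [h.1] <;>
      linarith [Real.rpow_nonneg ha r, Real.rpow_nonneg hb r]
  rw [Real.mul_rpow zero_le_two hm] at h1
  have h3 : (2 : ℝ) ^ r ≤ 2 ^ s := Real.rpow_le_rpow_of_exponent_le one_le_two hrs
  calc (a + b) ^ r ≤ 2 ^ r * (max a b) ^ r := h1
    _ ≤ 2 ^ s * (a ^ r + b ^ r) := by gcongr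

/-- Substitute for the triangle inequality: the modular is not homogeneous, but the upper bound on
the exponent gives a uniform factor. -/
theorem modular_add_le (hΩ : MeasurableSet Ω) (hpc : ContinuousOn p Ω)
    (hp : ∀ x ∈ Ω, 0 ≤ p x ∧ p x ≤ pp) {f g : 𝔼 n → F}
    (hf : AEStronglyMeasurable f (volume.restrict Ω)) :
    modular p Ω (fun x => f x + g x) ≤
      ENNReal.ofReal (2 ^ pp) * (modular p Ω f + modular p Ω g) := by
  unfold modular
  rw [← lintegral_add_left' (aemeasurable_ofReal_norm_rpow hΩ hpc hf),
    ← lintegral_const_mul' _ _ ENNReal.ofReal_ne_top]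
  refine setLIntegral_mono' hΩ fun x hx => ?_
  rw [← ENNReal.ofReal_add (by positivity) (by positivity), ← ENNReal.ofReal_mul (by positivity)]
  refine ENNReal.ofReal_le_ofReal ?_
  exact (Real.rpow_le_rpow (norm_nonneg _) (norm_add_le _ _) (hp x hx).1).trans
    (add_rpow_le_two_rpow_mul (norm_nonneg _) (norm_nonneg _) (hp x hx).1 (hp x hx).2)

theorem modular_neg (f : 𝔼 n → F) : modular p Ω (fun x => -f x) = modular p Ω f := by
  simp [modular]

theorem modular_sub_le (hΩ : MeasurableSet Ω) (hpc : ContinuousOn p Ω)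
    (hp : ∀ x ∈ Ω, 0 ≤ p x ∧ p x ≤ pp) {f g : 𝔼 n → F}
    (hf : AEStronglyMeasurable f (volume.restrict Ω)) :
    modular p Ω (fun x => f x - g x) ≤
      ENNReal.ofReal (2 ^ pp) * (modular p Ω f + modular p Ω g) := by
  simpa [sub_eq_add_neg, modular_neg] using modular_add_le (g := fun x => -g x) hΩ hpc hp hf

variable [NormedSpace ℝ F]

theorem modular_smul_le (hΩ : MeasurableSet Ω) {c C : ℝ} (hc : 0 ≤ c)
    (h : ∀ x ∈ Ω, c ^ p x ≤ C) (f : 𝔼 n → F) :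
    modular p Ω (fun x => c • f x) ≤ ENNReal.ofReal C * modular p Ω f := by
  unfold modular
  rw [← lintegral_const_mul' _ _ ENNReal.ofReal_ne_top]
  refine setLIntegral_mono' hΩ fun x hx => ?_
  have hC : 0 ≤ C := (Real.rpow_nonneg hc _).trans (h x hx)
  rw [← ENNReal.ofReal_mul hC, norm_smul, Real.norm_of_nonneg hc,
    Real.mul_rpow hc (norm_nonneg _)]
  exact ENNReal.ofReal_le_ofReal (mul_le_mul_of_nonneg_right (h x hx) (by positivity))

theorem modular_lt_top_of_luxNorm_lt_top (hΩ : MeasurableSet Ω)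
    (hp : ∀ x ∈ Ω, 0 ≤ p x ∧ p x ≤ pp) {f : 𝔼 n → F} (h : luxNorm p Ω f < ⊤) :
    modular p Ω f < ⊤ := by
  obtain ⟨t, ht⟩ := iInf_lt_iff.1 h
  obtain ⟨⟨ht0, hm⟩, -⟩ := iInf_lt_iff.1 ht
  have hf : f = fun x => t • (t⁻¹ • f x) := by
    funext x; rw [smul_smul, mul_inv_cancel₀ ht0.ne', one_smul]
  rw [hf]
  refine (modular_smul_le hΩ ht0.le (C := (max t 1) ^ pp) (fun x hx => ?_) _).trans_lt
    (ENNReal.mul_lt_top ENNReal.ofReal_lt_top (hm.trans_lt ENNReal.one_lt_top))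
  exact (Real.rpow_le_rpow ht0.le (le_max_left _ _) (hp x hx).1).trans
    (Real.rpow_le_rpow_of_exponent_le (le_max_right _ _) (hp x hx).2)

theorem inv_rpow_le_inv {t r : ℝ} (ht : 1 ≤ t) (hr : 1 ≤ r) : t⁻¹ ^ r ≤ t⁻¹ := by
  have h := Real.rpow_le_rpow_of_exponent_ge (inv_pos.2 (zero_lt_one.trans_le ht))
    (inv_le_one_of_one_le₀ ht) hr
  rwa [Real.rpow_one] at h

theorem luxNorm_lt_top_of_modular_lt_top (hΩ : MeasurableSet Ω)
    (hp : ∀ x ∈ Ω, 1 ≤ p x) {f : 𝔼 n → F} (h : modular p Ω f < ⊤) :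
    luxNorm p Ω f < ⊤ := by
  -- For `t ≥ 1` and exponents at least `1`, dividing `f` by `t` divides the modular by at least
  -- `t`; so `t` only has to exceed `1` and the modular.
  set t : ℝ := max 1 (modular p Ω f).toReal with ht
  have ht1 : 1 ≤ t := le_max_left _ _
  have ht0 : 0 < t := zero_lt_one.trans_le ht1
  refine (iInf₂_le t ⟨ht0, ?_⟩).trans_lt ENNReal.ofReal_lt_top
  refine (modular_smul_le hΩ (inv_pos.2 ht0).le
    (fun x hx => inv_rpow_le_inv ht1 (hp x hx)) _).trans ?_
  rw [← ENNReal.ofReal_toReal h.ne, ← ENNReal.ofReal_mul (inv_pos.2 ht0).le, ← ENNReal.ofReal_one]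
  refine ENNReal.ofReal_le_ofReal ?_
  rw [inv_mul_le_iff₀ ht0, mul_one]
  exact le_max_right _ _

theorem modular_le_of_luxNorm_lt (hΩ : MeasurableSet Ω)
    (hp : ∀ x ∈ Ω, 1 ≤ p x) {f : 𝔼 n → F} {ε : ℝ} (hε : ε ≤ 1)
    (h : luxNorm p Ω f < ENNReal.ofReal ε) : modular p Ω f ≤ ENNReal.ofReal ε := by
  obtain ⟨t, ht⟩ := iInf_lt_iff.1 h
  obtain ⟨⟨ht0, hm⟩, htε⟩ := iInf_lt_iff.1 ht
  have hf : f = fun x => t • (t⁻¹ • f x) := by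
    funext x; rw [smul_smul, mul_inv_cancel₀ ht0.ne', one_smul]
  have htε' : t < ε := (ENNReal.ofReal_lt_ofReal_iff_of_nonneg ht0.le).1 htε
  rw [hf]
  refine (modular_smul_le hΩ ht0.le (C := t) (fun x hx => ?_) _).trans ?_
  · simpa using Real.rpow_le_rpow_of_exponent_ge ht0 (htε'.le.trans hε) (hp x hx)
  · calc ENNReal.ofReal t * modular p Ω (fun x => t⁻¹ • f x) ≤ ENNReal.ofReal t * 1 := by gcongr
      _ ≤ ENNReal.ofReal ε := by rw [mul_one]; exact htε.le

/-- Dividing by `ε ≤ 1` multiplies the modular by at most `ε⁻¹ ^ pp`, which is why smallness `ε ^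
pp` is required. -/
theorem luxNorm_le_of_modular_le (hΩ : MeasurableSet Ω)
    (hp : ∀ x ∈ Ω, p x ≤ pp) {f : 𝔼 n → F} {ε : ℝ} (hε0 : 0 < ε) (hε : ε ≤ 1)
    (h : modular p Ω f ≤ ENNReal.ofReal (ε ^ pp)) : luxNorm p Ω f ≤ ENNReal.ofReal ε := by
  refine iInf₂_le ε ⟨hε0, ?_⟩
  refine (modular_smul_le hΩ (inv_pos.2 hε0).le (C := ε⁻¹ ^ pp) (fun x hx =>
    Real.rpow_le_rpow_of_exponent_le ((one_le_inv₀ hε0).2 hε) (hp x hx)) _).trans ?_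
  calc ENNReal.ofReal (ε⁻¹ ^ pp) * modular p Ω f
      ≤ ENNReal.ofReal (ε⁻¹ ^ pp) * ENNReal.ofReal (ε ^ pp) := by gcongr
    _ = 1 := by
      rw [← ENNReal.ofReal_mul (by positivity), ← Real.mul_rpow (by positivity) hε0.le,
        inv_mul_cancel₀ hε0.ne', Real.one_rpow, ENNReal.ofReal_one]

/-- Approximability of the pair `(u, G)` by test functions and their gradients, with respect to
the modular. For bounded exponents this is equivalent to approximability in the Luxemburg norm. -/
def ModularApprox (p : 𝔼 n → ℝ) (Ω : Set (𝔼 n)) (u : 𝔼 n → ℝ) (G : 𝔼 n → 𝔼 n) : Prop :=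
  ∀ ε : ℝ, 0 < ε → ∃ φ, IsTestFunction Ω φ ∧
    modular p Ω (fun x => u x - φ x) ≤ ENNReal.ofReal ε ∧
    modular p Ω (fun x => G x - gradient φ x) ≤ ENNReal.ofReal ε

theorem modularApprox_of_luxNorm (hΩ : MeasurableSet Ω) (hp : ∀ x ∈ Ω, 1 ≤ p x)
    {u : 𝔼 n → ℝ} {G : 𝔼 n → 𝔼 n}
    (h : ∀ ε : ℝ≥0∞, 0 < ε → ∃ φ, IsTestFunction Ω φ ∧
      luxNorm p Ω (fun x => u x - φ x) + luxNorm p Ω (fun x => G x - gradient φ x) < ε) :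
    ModularApprox p Ω u G := by
  intro ε hε
  obtain ⟨φ, hφ, hlt⟩ := h (ENNReal.ofReal (min ε 1)) (by simp [hε])
  have hle : ENNReal.ofReal (min ε 1) ≤ ENNReal.ofReal ε :=
    ENNReal.ofReal_le_ofReal (min_le_left _ _)
  exact ⟨φ, hφ,
    (modular_le_of_luxNorm_lt hΩ hp (min_le_right _ _) (le_self_add.trans_lt hlt)).trans hle,
    (modular_le_of_luxNorm_lt hΩ hp (min_le_right _ _) (le_add_self.trans_lt hlt)).trans hle⟩

theorem ModularApprox.luxNorm (hΩ : MeasurableSet Ω) (hp : ∀ x ∈ Ω, p x ≤ pp)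
    {u : 𝔼 n → ℝ} {G : 𝔼 n → 𝔼 n} (h : ModularApprox p Ω u G) (ε : ℝ≥0∞) (hε : 0 < ε) :
    ∃ φ, IsTestFunction Ω φ ∧
      luxNorm p Ω (fun x => u x - φ x) + luxNorm p Ω (fun x => G x - gradient φ x) < ε := by
  obtain ⟨δ, hδ0, hδ⟩ : ∃ δ : ℝ, 0 < δ ∧ ENNReal.ofReal (δ + δ) < ε := by
    obtain ⟨r, -, hr⟩ := ENNReal.lt_iff_exists_real_btwn.1 hε
    have hr0 : 0 < r := by
      by_contra hcon
      simp [ENNReal.ofReal_of_nonpos (not_lt.1 hcon)] at hr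
    exact ⟨r / 2, by positivity, by simpa using hr.2⟩
  set δ' := min δ 1
  have hδ'0 : 0 < δ' := by positivity
  obtain ⟨φ, hφ, h1, h2⟩ := h (δ' ^ pp) (by positivity)
  refine ⟨φ, hφ, lt_of_le_of_lt ?_ hδ⟩
  rw [ENNReal.ofReal_add hδ0.le hδ0.le]
  have hle : ENNReal.ofReal δ' ≤ ENNReal.ofReal δ := ENNReal.ofReal_le_ofReal (min_le_left _ _)
  exact add_le_add ((luxNorm_le_of_modular_le hΩ hp hδ'0 (min_le_right _ _) h1).trans hle)
    ((luxNorm_le_of_modular_le hΩ hp hδ'0 (min_le_right _ _) h2).trans hle)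

end Modular

/-! ### Mollification in variable exponent spaces. -/

section Mollifier

variable {n : ℕ} {F : Type*} [NormedAddCommGroup F] [NormedSpace ℝ F]

/-- A bump function at the origin with outer radius `1 / (j + 1)`. -/
noncomputable def shrinkingBump (n j : ℕ) : ContDiffBump (0 : 𝔼 n) where
  rIn := 1 / (2 * ((j : ℝ) + 1))
  rOut := 1 / ((j : ℝ) + 1)
  rIn_pos := by positivity
  rIn_lt_rOut := by
    apply one_div_lt_one_div_of_lt <;> linarith [(Nat.cast_nonneg j : (0 : ℝ) ≤ j)]

/-- A smooth probability density supported in the ball of radius `1 / (j + 1)`. -/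
noncomputable def mollifier (n j : ℕ) : 𝔼 n → ℝ := (shrinkingBump n j).normed volume

/-- The mollification of a function at scale `1 / (j + 1)`. -/
noncomputable def mollify (j : ℕ) (f : 𝔼 n → F) : 𝔼 n → F :=
  mollifier n j ⋆[ContinuousLinearMap.lsmul ℝ ℝ, volume] f

theorem mollifier_nonneg (j : ℕ) (x : 𝔼 n) : 0 ≤ mollifier n j x :=
  (shrinkingBump n j).nonneg_normed x

theorem integral_mollifier (j : ℕ) : ∫ x, mollifier n j x = 1 :=
  (shrinkingBump n j).integral_normed

theorem integrable_mollifier (j : ℕ) : Integrable (mollifier n j) :=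
  (shrinkingBump n j).integrable_normed

theorem continuous_mollifier (j : ℕ) : Continuous (mollifier n j) :=
  (shrinkingBump n j).continuous_normed

theorem contDiff_mollifier (j : ℕ) : ContDiff ℝ ∞ (mollifier n j) :=
  (shrinkingBump n j).contDiff_normed

theorem hasCompactSupport_mollifier (j : ℕ) : HasCompactSupport (mollifier n j) :=
  (shrinkingBump n j).hasCompactSupport_normed

theorem norm_lt_of_mollifier_ne_zero {j : ℕ} {x : 𝔼 n} (h : mollifier n j x ≠ 0) :
    ‖x‖ < 1 / ((j : ℝ) + 1) := by
  have : x ∈ Function.support ((shrinkingBump n j).normed volume) := h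
  rw [ContDiffBump.support_normed_eq] at this
  simpa [shrinkingBump] using this

/-- The density is at most the inverse volume of the inner ball, whose radius is `1 / (2 (j + 1))`.
Growth polynomial in `j` is all that a Lipschitz exponent can absorb here. -/
theorem exists_mollifier_le (n : ℕ) :
    ∃ C : ℝ, 0 ≤ C ∧ ∀ j (x : 𝔼 n), mollifier n j x ≤ C * ((j : ℝ) + 1) ^ n := by
  refine ⟨2 ^ n / volume.real (Metric.ball (0 : 𝔼 n) 1), by positivity, fun j x => ?_⟩
  refine ((shrinkingBump n j).normed_le_div_measure_closedBall_rIn volume x).trans (le_of_eq ?_)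
  rw [Measure.addHaar_real_closedBall _ _ (shrinkingBump n j).rIn_pos.le]
  simp [shrinkingBump, mul_pow]
  ring

theorem mollify_eq (j : ℕ) (f : 𝔼 n → F) (x : 𝔼 n) :
    mollify j f x = ∫ y, mollifier n j (x - y) • f y := by
  rw [mollify, convolution_eq_swap]
  rfl

theorem integrable_mollifier_sub (j : ℕ) (x : 𝔼 n) :
    Integrable fun y => mollifier n j (x - y) :=
  (integrable_mollifier j).comp_sub_left x

theorem integral_mollifier_sub (j : ℕ) (x : 𝔼 n) : ∫ y, mollifier n j (x - y) = 1 := by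
  rw [integral_sub_left_eq_self (fun y => mollifier n j y), integral_mollifier]

theorem integrable_mollifier_smul (j : ℕ) {f : 𝔼 n → F} (hf : Integrable f) (x : 𝔼 n) :
    Integrable fun y => mollifier n j (x - y) • f y := by
  obtain ⟨C, -, hC⟩ := exists_mollifier_le n
  refine hf.bdd_smul (C * ((j : ℝ) + 1) ^ n)
    ((continuous_mollifier j).comp (by fun_prop)).aestronglyMeasurable ?_
  filter_upwards with y
  rw [Real.norm_of_nonneg (mollifier_nonneg _ _)]
  exact hC j _

theorem mollify_eq_zero {j : ℕ} {f : 𝔼 n → F} {K : Set (𝔼 n)} (hf : ∀ x ∉ K, f x = 0)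
    {x : 𝔼 n} (hx : x ∉ Metric.cthickening (1 / ((j : ℝ) + 1)) K) : mollify j f x = 0 := by
  rw [mollify_eq]
  refine integral_eq_zero_of_ae (Eventually.of_forall fun y => ?_)
  by_cases hy : y ∈ K
  · by_cases h0 : mollifier n j (x - y) = 0
    · simp [h0]
    · refine absurd (Metric.mem_cthickening_of_dist_le x y _ K hy ?_) hx
      rw [dist_eq_norm]
      exact (norm_lt_of_mollifier_ne_zero h0).le
  · simp [hf y hy]

theorem ae_tendsto_mollify [CompleteSpace F] {f : 𝔼 n → F} (hf : Integrable f) :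
    ∀ᵐ x, Tendsto (fun j => mollify j f x) atTop (𝓝 (f x)) := by
  -- `K = 2` is the ratio of the outer to the inner radius, the same at every scale.
  refine ContDiffBump.ae_convolution_tendsto_right_of_locallyIntegrable (K := 2)
    (φ := shrinkingBump n) ?_ (Eventually.of_forall fun j => ?_) hf.locallyIntegrable
  · exact tendsto_one_div_add_atTop_nhds_zero_nat
  · simp only [shrinkingBump]
    field_simp
    rfl

theorem integrable_mollify (j : ℕ) {f : 𝔼 n → F} (hf : Integrable f) :
    Integrable (mollify j f) :=
  (integrable_mollifier j).integrable_convolution _ hf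

theorem integral_mollify (j : ℕ) {f : 𝔼 n → ℝ} (hf : Integrable f) :
    ∫ x, mollify j f x = ∫ x, f x := by
  unfold mollify
  rw [integral_convolution _ (integrable_mollifier j) hf, integral_mollifier]
  simp

theorem mollify_nonneg (j : ℕ) {f : 𝔼 n → ℝ} (hf : ∀ x, 0 ≤ f x) (x : 𝔼 n) :
    0 ≤ mollify j f x := by
  rw [mollify_eq]
  exact integral_nonneg fun y => mul_nonneg (mollifier_nonneg _ _) (hf y)

/-- The Scheffé lemma. -/
theorem tendsto_integral_abs_sub_of_tendsto_integral {α : Type*} [MeasurableSpace α]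
    {μ : Measure α} {f : ℕ → α → ℝ} {g : α → ℝ} (hf : ∀ j, Integrable (f j) μ)
    (hg : Integrable g μ) (hf0 : ∀ j x, 0 ≤ f j x) (hg0 : ∀ x, 0 ≤ g x)
    (hlim : ∀ᵐ x ∂μ, Tendsto (fun j => f j x) atTop (𝓝 (g x)))
    (hint : Tendsto (fun j => ∫ x, f j x ∂μ) atTop (𝓝 (∫ x, g x ∂μ))) :
    Tendsto (fun j => ∫ x, |f j x - g x| ∂μ) atTop (𝓝 0) := by
  -- Only the part of the difference below `g` has an integrable majorant. The rest is recovered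
  -- from the integrals, by `|b - a| = 2 (a - b)⁺ + (b - a)`.
  have h1 : Tendsto (fun j => ∫ x, max (g x - f j x) 0 ∂μ) atTop (𝓝 (∫ _, (0 : ℝ) ∂μ)) := by
    refine tendsto_integral_of_dominated_convergence g
      (fun j => (hg.sub (hf j)).pos_part.aestronglyMeasurable) hg (fun j => ?_) ?_
    · filter_upwards with x
      rw [Real.norm_of_nonneg (le_max_right _ _)]
      exact max_le (by linarith [hf0 j x]) (hg0 x)
    · filter_upwards [hlim] with x hx
      have := (hx.const_sub (g x)).max (tendsto_const_nhds (x := (0 : ℝ)))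
      simpa using this
  have h2 : ∀ j, ∫ x, |f j x - g x| ∂μ =
      2 * (∫ x, max (g x - f j x) 0 ∂μ) + (∫ x, f j x ∂μ - ∫ x, g x ∂μ) := by
    intro j
    rw [← integral_sub (hf j) hg, ← integral_const_mul, ← integral_add]
    · refine integral_congr_ae (Eventually.of_forall fun x => ?_)
      rcases le_total (g x - f j x) 0 with h | h
      · simp only [max_eq_right h]
        rw [abs_of_nonneg (by linarith)]; ring
      · simp only [max_eq_left h]
        rw [abs_of_nonpos (by linarith)]; ring
    · exact (hg.sub (hf j)).pos_part.const_mul 2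
    · exact (hf j).sub hg
  simp only [h2]
  simpa using (h1.const_mul 2).add (hint.sub_const (∫ x, g x ∂μ))

theorem tendsto_integral_abs_mollify_sub {f : 𝔼 n → ℝ} (hf : Integrable f) (hf0 : ∀ x, 0 ≤ f x) :
    Tendsto (fun j => ∫ x, |mollify j f x - f x|) atTop (𝓝 0) := by
  refine tendsto_integral_abs_sub_of_tendsto_integral (fun j => integrable_mollify j hf) hf
    (fun j => mollify_nonneg j hf0) hf0 (ae_tendsto_mollify hf) ?_
  simp only [integral_mollify _ hf]
  exact tendsto_const_nhds

/-- With `N = j + 1` the essential factor is `N ^ (n L / N) = exp (n L log N / N)`, bounded since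
`log N ≤ N`. -/
theorem exists_one_add_mul_pow_rpow_le (n : ℕ) {A L : ℝ} (hA : 0 ≤ A) (hL : 0 ≤ L) :
    ∃ C : ℝ, ∀ j : ℕ, (1 + A * ((j : ℝ) + 1) ^ n) ^ (L / ((j : ℝ) + 1)) ≤ C := by
  refine ⟨(1 + A) ^ L * Real.exp (n * L), fun j => ?_⟩
  set N : ℝ := (j : ℝ) + 1 with hN
  have hN1 : 1 ≤ N := by simp [hN]
  have hN0 : 0 < N := by linarith
  have hNn : 1 ≤ N ^ n := one_le_pow₀ hN1
  have h1 : 1 + A * N ^ n ≤ (1 + A) * N ^ n := by nlinarith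
  calc (1 + A * N ^ n) ^ (L / N) ≤ ((1 + A) * N ^ n) ^ (L / N) :=
        Real.rpow_le_rpow (by positivity) h1 (by positivity)
    _ = (1 + A) ^ (L / N) * (N ^ n) ^ (L / N) := Real.mul_rpow (by positivity) (by positivity)
    _ ≤ (1 + A) ^ L * Real.exp (n * L) := by
      gcongr
      · linarith
      · exact div_le_self hL hN1
      · rw [Real.rpow_def_of_pos (by positivity), Real.log_pow, Real.exp_le_exp]
        have hlog : Real.log N ≤ N := (Real.log_le_sub_one_of_pos hN0).trans (by linarith)
        calc (n : ℝ) * Real.log N * (L / N) ≤ n * N * (L / N) := by gcongr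
          _ = n * L := by field_simp

/-- This trades the exponent `s = p y` for `r = p x`. Beyond the threshold `A = M ^ r⁻¹`, the ratio
`t / A` exceeds `1` and so is at most `t ^ s / M ^ (s / r)`; replacing `M ^ (s / r)` by `M` costs at
most the factor `C`. -/
theorem le_rpow_mul_one_add {t M r s C : ℝ} (ht : 0 ≤ t) (hM : 1 ≤ M) (hr : 1 ≤ r) (hs : 1 ≤ s)
    (hC : M ^ |r - s| ≤ C) : t ≤ M ^ r⁻¹ * (1 + C * t ^ s / M) := by
  have hM0 : 0 < M := by linarith
  have hA0 : 0 < M ^ r⁻¹ := by positivity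
  have hC0 : 0 < C := (by positivity : 0 < M ^ |r - s|).trans_le hC
  rcases le_or_gt t (M ^ r⁻¹) with h | h
  · refine h.trans (le_mul_of_one_le_right hA0.le ?_)
    have : 0 ≤ C * t ^ s / M := by positivity
    linarith
  · have h1 : 1 ≤ t / M ^ r⁻¹ := (one_le_div hA0).2 h.le
    have h2 : t / M ^ r⁻¹ ≤ (t / M ^ r⁻¹) ^ s := by
      simpa using Real.rpow_le_rpow_of_exponent_le h1 hs
    rw [Real.div_rpow ht hA0.le, ← Real.rpow_mul hM0.le] at h2
    have h3 : M / C ≤ M ^ (r⁻¹ * s) := by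
      have e1 : r⁻¹ * s = 1 + (s - r) / r := by field_simp; ring
      rw [e1, Real.rpow_add hM0, Real.rpow_one, div_eq_mul_inv]
      refine mul_le_mul_of_nonneg_left ?_ hM0.le
      calc C⁻¹ ≤ (M ^ |r - s|)⁻¹ := inv_anti₀ (by positivity) hC
        _ = M ^ (-|r - s|) := (Real.rpow_neg hM0.le _).symm
        _ ≤ M ^ ((s - r) / r) := by
          refine Real.rpow_le_rpow_of_exponent_le hM ?_
          have : |(s - r) / r| ≤ |r - s| := by
            rw [abs_div, abs_sub_comm, abs_of_pos (by linarith : 0 < r)]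
            exact div_le_self (abs_nonneg _) hr
          exact (neg_le_neg this).trans (neg_abs_le _)
    have h4 : t / M ^ r⁻¹ ≤ C * t ^ s / M := by
      refine h2.trans ((div_le_div_of_nonneg_left (by positivity) (by positivity) h3).trans
        (le_of_eq ?_))
      field_simp
    rw [div_le_iff₀ hA0] at h4
    nlinarith

variable {p : 𝔼 n → ℝ} {Ω : Set (𝔼 n)} {pp : ℝ}

/-- Mollification is bounded with respect to the modular of a Lipschitz exponent. -/
theorem exists_norm_mollify_rpow_le (hp : ∀ x ∈ Ω, 1 ≤ p x ∧ p x ≤ pp)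
    (hpLip : ∃ K, LipschitzOnWith K p Ω) {K : Set (𝔼 n)} (hKΩ : K ⊆ Ω)
    {f : 𝔼 n → F} (hfK : ∀ x ∉ K, f x = 0) (hf : Integrable f)
    (hfp : Integrable (K.indicator fun x => ‖f x‖ ^ p x)) :
    ∃ C : ℝ, 0 ≤ C ∧ ∀ j, ∀ x ∈ Ω,
      ‖mollify j f x‖ ^ p x ≤ C * (1 + mollify j (K.indicator fun x => ‖f x‖ ^ p x) x) := by
  obtain ⟨L, hL⟩ := hpLip
  set Φ : 𝔼 n → ℝ := K.indicator fun x => ‖f x‖ ^ p x with hΦ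
  have hΦ0 : ∀ x, 0 ≤ Φ x := fun x => indicator_nonneg (fun y _ => by positivity) x
  obtain ⟨B, hB0, hB⟩ := exists_mollifier_le n
  have hI : 0 ≤ ∫ x, Φ x := integral_nonneg hΦ0
  obtain ⟨C, hC⟩ := exists_one_add_mul_pow_rpow_le n (mul_nonneg hB0 hI) L.coe_nonneg
  have hCpos : 0 < C := lt_of_lt_of_le (by positivity) (hC 0)
  refine ⟨(1 + C) ^ pp, by positivity, fun j x hx => ?_⟩
  set M : ℝ := 1 + mollify j Φ x with hM
  have hM1 : 1 ≤ M := by linarith [mollify_nonneg j hΦ0 x]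
  have hM0 : 0 < M := by linarith
  -- The only bound on `M` as `j` grows; raised to the power `L / (j + 1)` it stays below `C`.
  have hMle : M ≤ 1 + B * (∫ x, Φ x) * ((j : ℝ) + 1) ^ n := by
    have : mollify j Φ x ≤ ∫ y, B * ((j : ℝ) + 1) ^ n * Φ y := by
      rw [mollify_eq]
      refine integral_mono (integrable_mollifier_smul j hfp x) (hfp.const_mul _) fun y => ?_
      exact mul_le_mul_of_nonneg_right (hB j _) (hΦ0 y)
    rw [integral_const_mul] at this
    linarith
  -- Integrating this in `y` gives the bound: the mollifier has mass `1`, and the average of `Φ` is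
  -- `M - 1`.
  have hpt : ∀ y, mollifier n j (x - y) * ‖f y‖ ≤
      M ^ (p x)⁻¹ * (mollifier n j (x - y) + C / M * (mollifier n j (x - y) * Φ y)) := by
    intro y
    have hη := mollifier_nonneg j (x - y)
    by_cases hy : y ∈ K
    · by_cases h0 : mollifier n j (x - y) = 0
      · simp [h0]
      · have hd : |p x - p y| ≤ L / ((j : ℝ) + 1) := by
          have h1 := hL.dist_le_mul x hx y (hKΩ hy)
          rw [Real.dist_eq, dist_eq_norm] at h1
          refine h1.trans ?_
          rw [div_eq_mul_one_div]
          exact mul_le_mul_of_nonneg_left (norm_lt_of_mollifier_ne_zero h0).le L.coe_nonneg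
        have hMC : M ^ |p x - p y| ≤ C := by
          refine le_trans ?_ (hC j)
          exact (Real.rpow_le_rpow_of_exponent_le hM1 hd).trans
            (Real.rpow_le_rpow hM0.le hMle (by positivity))
        have h2 := le_rpow_mul_one_add (norm_nonneg (f y)) hM1 (hp x hx).1 (hp y (hKΩ hy)).1 hMC
        have e : Φ y = ‖f y‖ ^ p y := indicator_of_mem hy _
        rw [e]
        calc mollifier n j (x - y) * ‖f y‖ ≤ mollifier n j (x - y) *
              (M ^ (p x)⁻¹ * (1 + C * ‖f y‖ ^ p y / M)) := mul_le_mul_of_nonneg_left h2 hη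
          _ = _ := by ring
    · rw [hfK y hy, norm_zero, mul_zero]
      have := hΦ0 y
      positivity
  have hle : ‖mollify j f x‖ ≤ M ^ (p x)⁻¹ * (1 + C) := by
    calc ‖mollify j f x‖ ≤ ∫ y, ‖mollifier n j (x - y) • f y‖ := by
          rw [mollify_eq]; exact norm_integral_le_integral_norm _
      _ ≤ ∫ y, M ^ (p x)⁻¹ *
          (mollifier n j (x - y) + C / M * (mollifier n j (x - y) * Φ y)) := by
        refine integral_mono (integrable_mollifier_smul j hf x).norm ?_ fun y => ?_
        · exact ((integrable_mollifier_sub j x).add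
            ((integrable_mollifier_smul j hfp x).const_mul _)).const_mul _
        · simp only [norm_smul, Real.norm_of_nonneg (mollifier_nonneg j (x - y))]
          exact hpt y
      _ = M ^ (p x)⁻¹ * (1 + C / M * (M - 1)) := by
        have hi : Integrable fun y => mollifier n j (x - y) * Φ y :=
          integrable_mollifier_smul j hfp x
        have hMe : M - 1 = ∫ y, mollifier n j (x - y) * Φ y := by
          rw [hM, add_sub_cancel_left, mollify_eq]; rfl
        rw [integral_const_mul, integral_add (integrable_mollifier_sub j x) (hi.const_mul _),
          integral_const_mul, integral_mollifier_sub, hMe]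
      _ ≤ M ^ (p x)⁻¹ * (1 + C) := by
        have : C / M * (M - 1) ≤ C := by
          rw [div_mul_eq_mul_div, div_le_iff₀ hM0]; nlinarith
        gcongr
  have hp0 : 0 < p x := by linarith [(hp x hx).1]
  calc ‖mollify j f x‖ ^ p x ≤ (M ^ (p x)⁻¹ * (1 + C)) ^ p x :=
        Real.rpow_le_rpow (norm_nonneg _) hle hp0.le
    _ = M * (1 + C) ^ p x := by
      rw [Real.mul_rpow (by positivity) (by positivity), ← Real.rpow_mul hM0.le,
        inv_mul_cancel₀ hp0.ne', Real.rpow_one]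
    _ ≤ M * (1 + C) ^ pp := by
      refine mul_le_mul_of_nonneg_left ?_ hM0.le
      exact Real.rpow_le_rpow_of_exponent_le (by linarith) (hp x hx).2
    _ = (1 + C) ^ pp * M := mul_comm _ _

/-- A generalised dominated convergence: the integrands tend to zero a.e. and are bounded by a fixed
integrable function plus a multiple of `|mollify j Φ - Φ|`, which tends to zero in `L¹` by Scheffé.
-/
theorem tendsto_modular_mollify_sub [CompleteSpace F] (hΩ : IsOpen Ω)
    (hp : ∀ x ∈ Ω, 1 ≤ p x ∧ p x ≤ pp)
    (hpLip : ∃ K, LipschitzOnWith K p Ω) {K : Set (𝔼 n)} (hK : IsCompact K) (hKΩ : K ⊆ Ω)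
    {f : 𝔼 n → F} (hfK : ∀ x ∉ K, f x = 0) (hf : Integrable f) (hm : modular p Ω f < ⊤) :
    Tendsto (fun j => modular p Ω (fun x => f x - mollify j f x)) atTop (𝓝 0) := by
  have hpc : ContinuousOn p Ω := hpLip.choose_spec.continuousOn
  have hΩm := hΩ.measurableSet
  have hfΩ : ∀ x ∈ Ω, (K.indicator fun x => ‖f x‖ ^ p x) x = ‖f x‖ ^ p x := by
    intro x hx
    by_cases hxK : x ∈ K
    · exact indicator_of_mem hxK _
    · rw [indicator_of_notMem hxK, hfK x hxK, norm_zero,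
        Real.zero_rpow (by linarith [(hp x hx).1])]
  have hfp : Integrable (K.indicator fun x => ‖f x‖ ^ p x) := by
    rw [integrable_indicator_iff hK.measurableSet]
    exact (integrableOn_norm_rpow hΩm hpc hf.aestronglyMeasurable.restrict hm).mono_set hKΩ
  obtain ⟨C, hC0, hC⟩ := exists_norm_mollify_rpow_le hp hpLip hKΩ hfK hf hfp
  set Φ : 𝔼 n → ℝ := K.indicator fun x => ‖f x‖ ^ p x with hΦ
  have hΦ0 : ∀ x, 0 ≤ Φ x := fun x => indicator_nonneg (fun y _ => by positivity) x
  -- All scales are at most `1`, so this one compact set contains every support. Off it the additive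
  -- constant in the bound `hC` can be dropped, which makes the majorant integrable.
  set K' := Metric.cthickening 1 K with hK'
  have hK'c : IsCompact K' := hK.cthickening
  have hsupp : ∀ j x, x ∉ K' → mollify j f x = 0 := by
    intro j x hx
    refine mollify_eq_zero hfK fun h => hx (Metric.cthickening_mono ?_ K h)
    rw [div_le_one (by positivity)]
    simp
  set D : ℝ := 2 ^ pp * (C + 1) with hD
  have hD0 : 0 ≤ D := by positivity
  set bd : 𝔼 n → ℝ := fun x => D * (K'.indicator (fun _ => 1) x + 2 * Φ x) with hbd
  have hbd0 : ∀ x, 0 ≤ bd x := fun x => mul_nonneg hD0 (add_nonneg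
    (indicator_nonneg (fun _ _ => zero_le_one) x) (mul_nonneg zero_le_two (hΦ0 x)))
  have hbdi : Integrable bd := by
    refine Integrable.const_mul (Integrable.add ?_ (hfp.const_mul 2)) D
    rw [integrable_indicator_iff hK'c.measurableSet]
    exact integrableOn_const hK'c.measure_lt_top.ne
  have key : ∀ j, ∀ x ∈ Ω, ‖f x - mollify j f x‖ ^ p x ≤ D * |mollify j Φ x - Φ x| + bd x := by
    intro j x hx
    have hp1 := hp x hx
    have hM0 := mollify_nonneg j hΦ0 x
    have h1 : ‖mollify j f x‖ ^ p x ≤ C * (K'.indicator (fun _ => 1) x + mollify j Φ x) := by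
      by_cases hxK : x ∈ K'
      · rw [indicator_of_mem hxK]; exact hC j x hx
      · rw [hsupp j x hxK, norm_zero, Real.zero_rpow (by linarith), indicator_of_notMem hxK]
        positivity
    have hi : 0 ≤ K'.indicator (fun _ => (1 : ℝ)) x :=
      indicator_nonneg (fun _ _ => zero_le_one) x
    have h2 := add_rpow_le_two_rpow_mul (norm_nonneg (f x)) (norm_nonneg (mollify j f x))
      (by linarith : 0 ≤ p x) hp1.2
    have h3 := Real.rpow_le_rpow (norm_nonneg _) (norm_sub_le (f x) (mollify j f x))
      (by linarith : 0 ≤ p x)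
    have h4 : mollify j Φ x ≤ |mollify j Φ x - Φ x| + Φ x := by
      linarith [le_abs_self (mollify j Φ x - Φ x)]
    have h5 : ‖f x‖ ^ p x + ‖mollify j f x‖ ^ p x ≤ (C + 1) *
        (|mollify j Φ x - Φ x| + (K'.indicator (fun _ => 1) x + 2 * Φ x)) := by
      rw [← hfΩ x hx]
      have h6 : C * (K'.indicator (fun _ => 1) x + mollify j Φ x) ≤
        C * (|mollify j Φ x - Φ x| + (K'.indicator (fun _ => 1) x + 2 * Φ x)) := by
        refine mul_le_mul_of_nonneg_left ?_ hC0
        linarith [hΦ0 x]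
      have h7 := abs_nonneg (mollify j Φ x - Φ x)
      have h8 := hΦ0 x
      change Φ x + _ ≤ _
      linarith
    calc _ ≤ _ := h3
      _ ≤ _ := h2
      _ ≤ 2 ^ pp * ((C + 1) * (|mollify j Φ x - Φ x| +
          (K'.indicator (fun _ => 1) x + 2 * Φ x))) := by gcongr
      _ = _ := by simp only [hbd, hD]; ring
  have hlim1 : Tendsto (fun j => ∫⁻ x in Ω, ENNReal.ofReal (D * |mollify j Φ x - Φ x|))
      atTop (𝓝 0) := by
    have hi : ∀ j, Integrable fun x => D * |mollify j Φ x - Φ x| := fun j =>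
      ((integrable_mollify j hfp).sub hfp).abs.const_mul D
    have h1 : Tendsto (fun j => ENNReal.ofReal (∫ x, D * |mollify j Φ x - Φ x|)) atTop (𝓝 0) := by
      rw [← ENNReal.ofReal_zero]
      refine ENNReal.tendsto_ofReal ?_
      simp only [integral_const_mul]
      simpa using (tendsto_integral_abs_mollify_sub hfp hΦ0).const_mul D
    refine tendsto_of_tendsto_of_tendsto_of_le_of_le tendsto_const_nhds h1
      (fun _ => zero_le) fun j => ?_
    rw [ofReal_integral_eq_lintegral_ofReal (hi j) (Eventually.of_forall fun x => by positivity)]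
    exact setLIntegral_le_lintegral _ _
  have hmeas : ∀ j, AEMeasurable (fun x => ENNReal.ofReal (‖f x - mollify j f x‖ ^ p x))
      (volume.restrict Ω) := fun j => aemeasurable_ofReal_norm_rpow hΩm hpc
        (hf.sub (integrable_mollify j hf)).aestronglyMeasurable.restrict
  -- From `A ≤ B + E` follows `A ≤ B + min A E`. The minimum has the fixed majorant `bd`, so
  -- ordinary dominated convergence applies to it.
  have hlim2 : Tendsto (fun j => ∫⁻ x in Ω, min (ENNReal.ofReal (‖f x - mollify j f x‖ ^ p x))
      (ENNReal.ofReal (bd x))) atTop (𝓝 (∫⁻ _ in Ω, (0 : ℝ≥0∞))) := by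
    refine tendsto_lintegral_of_dominated_convergence' (fun x => ENNReal.ofReal (bd x))
      (fun j => (hmeas j).min hbdi.aestronglyMeasurable.restrict.aemeasurable.ennreal_ofReal)
      (fun j => Eventually.of_forall fun x => min_le_right _ _) ?_ ?_
    · exact (hbdi.restrict (s := Ω)).lintegral_lt_top.ne
    · filter_upwards [ae_restrict_of_ae (ae_tendsto_mollify hf), ae_restrict_mem hΩm] with x hx hxΩ
      have h0 : Tendsto (fun j => ‖f x - mollify j f x‖ ^ p x) atTop (𝓝 0) := by
        have h1 : Tendsto (fun j => ‖f x - mollify j f x‖) atTop (𝓝 0) := by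
          simpa using (hx.const_sub (f x)).norm
        have hpx : 0 < p x := by linarith [(hp x hxΩ).1]
        simpa [Real.zero_rpow hpx.ne'] using h1.rpow_const (Or.inr hpx.le)
      refine tendsto_of_tendsto_of_tendsto_of_le_of_le tendsto_const_nhds
        (by simpa using ENNReal.tendsto_ofReal h0) (fun _ => zero_le) fun j => min_le_left _ _
  rw [lintegral_zero] at hlim2
  have hsum := hlim1.add hlim2
  rw [add_zero] at hsum
  refine tendsto_of_tendsto_of_tendsto_of_le_of_le tendsto_const_nhds hsum
    (fun _ => zero_le) fun j => ?_
  have hm1 : AEMeasurable (fun x => ENNReal.ofReal (D * |mollify j Φ x - Φ x|))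
      (volume.restrict Ω) := (((integrable_mollify j hfp).sub
        hfp).abs.const_mul D).aestronglyMeasurable.restrict.aemeasurable.ennreal_ofReal
  change ∫⁻ x in Ω, _ ≤ (∫⁻ x in Ω, _) + ∫⁻ x in Ω, _
  rw [← lintegral_add_left' hm1]
  refine setLIntegral_mono' hΩm fun x hx => ?_
  rcases le_total (ENNReal.ofReal (‖f x - mollify j f x‖ ^ p x)) (ENNReal.ofReal (bd x)) with h | h
  · rw [min_eq_left h]; exact le_add_self
  · rw [min_eq_right h, ← ENNReal.ofReal_add (by positivity) (hbd0 x)]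
    exact ENNReal.ofReal_le_ofReal (key j x hx)

end Mollifier

/-! ### Weak gradients: uniqueness, products and mollification. -/

section WeakGradient

variable {n : ℕ} {Ω : Set (𝔼 n)} {F : Type*} [NormedAddCommGroup F]

theorem integrable_of_locallyIntegrableOn {f : 𝔼 n → F} (hf : LocallyIntegrableOn f Ω)
    {K : Set (𝔼 n)} (hK : IsCompact K) (hKΩ : K ⊆ Ω) (h0 : ∀ x ∉ K, f x = 0) :
    Integrable f := by
  rw [← integrableOn_iff_integrable_of_support_subset (s := K)]
  · exact hf.integrableOn_compact_subset hKΩ hK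
  · intro x hx
    by_contra h
    exact hx (h0 x h)

variable [NormedSpace ℝ F]

theorem integrable_smul_of_locallyIntegrableOn {f : 𝔼 n → F} (hf : LocallyIntegrableOn f Ω)
    {K : Set (𝔼 n)} (hK : IsCompact K) (hKΩ : K ⊆ Ω) {ψ : 𝔼 n → ℝ} (hψ : Continuous ψ)
    (h0 : ∀ x ∉ K, ψ x = 0) : Integrable fun x => ψ x • f x := by
  rw [← integrableOn_iff_integrable_of_support_subset (s := K)]
  · exact (hf.integrableOn_compact_subset hKΩ hK).continuousOn_smul hψ.continuousOn hK
  · intro x hx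
    by_contra h
    exact hx (by simp [h0 x h])

theorem setIntegral_eq_integral_of_eq_zero {f : 𝔼 n → F} {K : Set (𝔼 n)} (hKΩ : K ⊆ Ω)
    (h0 : ∀ x ∉ K, f x = 0) : ∫ x in Ω, f x = ∫ x, f x :=
  setIntegral_eq_integral_of_forall_compl_eq_zero fun x hx => h0 x fun h => hx (hKΩ h)

/-- A smooth cutoff which is `1` in a neighbourhood of a compact set. -/
theorem exists_isTestFunction_eq_one_nhds (hΩ : IsOpen Ω) {K : Set (𝔼 n)} (hK : IsCompact K)
    (hKΩ : K ⊆ Ω) : ∃ χ, IsTestFunction Ω χ ∧ ∀ x ∈ K, ∀ᶠ y in 𝓝 x, χ y = 1 := by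
  obtain ⟨δ, hδ, hδΩ⟩ := hK.exists_cthickening_subset_open hΩ hKΩ
  obtain ⟨χ, hχ, -, hsupp, h1⟩ := exists_contMDiff_support_eq_eq_one_iff (n := ⊤)
    (modelWithCornersSelf ℝ (𝔼 n)) (Metric.isOpen_thickening (δ := δ) (E := K))
    (Metric.isClosed_cthickening (δ := δ / 2) (E := K))
    (Metric.cthickening_subset_thickening' hδ (by linarith) K)
  have ht : tsupport χ ⊆ Metric.cthickening δ K := by
    rw [tsupport, hsupp]
    exact closure_minimal (Metric.thickening_subset_cthickening _ _) Metric.isClosed_cthickening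
  refine ⟨χ, ⟨hχ.contDiff, hK.cthickening.of_isClosed_subset (isClosed_tsupport _) ht,
    ht.trans hδΩ⟩, fun x hx => ?_⟩
  have : Metric.thickening (δ / 2) K ∈ 𝓝 x :=
    Metric.isOpen_thickening.mem_nhds (Metric.self_subset_thickening (by positivity) K hx)
  filter_upwards [this] with y hy
  exact (h1 y).1 (Metric.thickening_subset_cthickening _ _ hy)

namespace IsTestFunction

variable {φ : 𝔼 n → ℝ}

theorem continuous (hφ : IsTestFunction Ω φ) : Continuous φ := hφ.1.continuous

theorem isCompact (hφ : IsTestFunction Ω φ) : IsCompact (tsupport φ) := hφ.2.1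

theorem subset (hφ : IsTestFunction Ω φ) : tsupport φ ⊆ Ω := hφ.2.2

theorem differentiable (hφ : IsTestFunction Ω φ) : Differentiable ℝ φ :=
  hφ.1.differentiable (by simp)

theorem eq_zero {x : 𝔼 n} (hx : x ∉ tsupport φ) : φ x = 0 :=
  image_eq_zero_of_notMem_tsupport hx

theorem fderiv_eq_zero {x : 𝔼 n} (hx : x ∉ tsupport φ) : fderiv ℝ φ x = 0 :=
  image_eq_zero_of_notMem_tsupport fun h => hx (tsupport_fderiv_subset ℝ h)

theorem gradient_eq_zero {x : 𝔼 n} (hx : x ∉ tsupport φ) : gradient φ x = 0 := by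
  simp [gradient, fderiv_eq_zero hx]

theorem continuous_fderiv_apply (hφ : IsTestFunction Ω φ) (e : 𝔼 n) :
    Continuous fun x => fderiv ℝ φ x e :=
  (hφ.1.continuous_fderiv (by simp)).clm_apply continuous_const

theorem mul (hφ : IsTestFunction Ω φ) {χ : 𝔼 n → ℝ} (hχ : ContDiff ℝ ∞ χ) :
    IsTestFunction Ω fun x => χ x * φ x :=
  ⟨hχ.mul hφ.1, hφ.2.1.mul_left, (tsupport_mul_subset_right (f := χ) (g := φ)).trans hφ.subset⟩

theorem neg (hφ : IsTestFunction Ω φ) : IsTestFunction Ω fun x => -φ x := by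
  simpa using hφ.mul (contDiff_const (c := (-1 : ℝ)))

theorem add (hφ : IsTestFunction Ω φ) {χ : 𝔼 n → ℝ} (hχ : IsTestFunction Ω χ) :
    IsTestFunction Ω fun x => φ x + χ x :=
  ⟨hφ.1.add hχ.1, hφ.2.1.add hχ.2.1,
    (tsupport_add φ χ).trans (union_subset hφ.subset hχ.subset)⟩

theorem integrable_fderiv_mul (hφ : IsTestFunction Ω φ) {u : 𝔼 n → ℝ}
    (hu : LocallyIntegrableOn u Ω) (e : 𝔼 n) : Integrable fun x => u x * fderiv ℝ φ x e := by
  simpa [mul_comm] using integrable_smul_of_locallyIntegrableOn hu hφ.isCompact hφ.subset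
    (hφ.continuous_fderiv_apply e) fun x hx => by simp [fderiv_eq_zero hx]

theorem integrable_smul (hφ : IsTestFunction Ω φ) {G : 𝔼 n → F}
    (hG : LocallyIntegrableOn G Ω) : Integrable fun x => φ x • G x :=
  integrable_smul_of_locallyIntegrableOn hG hφ.isCompact hφ.subset
    hφ.continuous fun x hx => by simp [eq_zero hx]

theorem integrable_mul_inner (hφ : IsTestFunction Ω φ) {G : 𝔼 n → 𝔼 n}
    (hG : LocallyIntegrableOn G Ω) (e : 𝔼 n) :
    Integrable fun x => φ x * inner ℝ (G x) e := by
  simpa [inner_smul_left] using (hφ.integrable_smul hG).inner_const (𝕜 := ℝ) e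

end IsTestFunction

theorem inner_gradient_eq_fderiv (u : 𝔼 n → ℝ) (x e : 𝔼 n) :
    inner ℝ (gradient u x) e = fderiv ℝ u x e := by
  simp [gradient]

theorem continuous_gradient {u : 𝔼 n → ℝ} (hu : ContDiff ℝ 1 u) : Continuous (gradient u) :=
  (InnerProductSpace.toDual ℝ (𝔼 n)).symm.continuous.comp (hu.continuous_fderiv (by simp))

theorem ContDiff.hasWeakGradient {u : 𝔼 n → ℝ} (hu : ContDiff ℝ 1 u) :
    HasWeakGradient Ω u (gradient u) := by
  have hul : LocallyIntegrableOn u Ω := hu.continuous.locallyIntegrable.locallyIntegrableOn _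
  have hGl : LocallyIntegrableOn (gradient u) Ω :=
    (continuous_gradient hu).locallyIntegrable.locallyIntegrableOn _
  refine ⟨hul, hGl, fun φ hφ e => ?_⟩
  have hi := hφ.integrable_mul_inner hGl e
  simp only [inner_gradient_eq_fderiv] at hi ⊢
  rw [setIntegral_eq_integral_of_eq_zero hφ.subset
      (fun x hx => by simp [IsTestFunction.fderiv_eq_zero hx]),
    setIntegral_eq_integral_of_eq_zero hφ.subset
      (fun x hx => by simp [IsTestFunction.eq_zero hx]),
    integral_mul_fderiv_eq_neg_fderiv_mul_of_integrable]
  · simp only [mul_comm]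
  · simpa only [mul_comm] using hi
  · exact hφ.integrable_fderiv_mul hul e
  · simpa [mul_comm] using hφ.integrable_smul hul
  · exact fun x _ => hu.differentiable (by simp) x
  · exact fun x _ => hφ.differentiable x

namespace HasWeakGradient

variable {u v : 𝔼 n → ℝ} {G H : 𝔼 n → 𝔼 n}

theorem add (hu : HasWeakGradient Ω u G) (hv : HasWeakGradient Ω v H) :
    HasWeakGradient Ω (fun x => u x + v x) (fun x => G x + H x) := by
  refine ⟨hu.1.add hv.1, hu.2.1.add hv.2.1, fun φ hφ e => ?_⟩
  simp only [add_mul, inner_add_left, mul_add]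
  rw [integral_add (hφ.integrable_fderiv_mul hu.1 e).restrict
      (hφ.integrable_fderiv_mul hv.1 e).restrict,
    integral_add (hφ.integrable_mul_inner hu.2.1 e).restrict
      (hφ.integrable_mul_inner hv.2.1 e).restrict, hu.2.2 φ hφ e, hv.2.2 φ hφ e, neg_add]

theorem neg (hu : HasWeakGradient Ω u G) :
    HasWeakGradient Ω (fun x => -u x) (fun x => -G x) := by
  refine ⟨hu.1.neg, hu.2.1.neg, fun φ hφ e => ?_⟩
  simp only [neg_mul, inner_neg_left, mul_neg, integral_neg, hu.2.2 φ hφ e]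

theorem sub (hu : HasWeakGradient Ω u G) (hv : HasWeakGradient Ω v H) :
    HasWeakGradient Ω (fun x => u x - v x) (fun x => G x - H x) := by
  simpa [sub_eq_add_neg] using hu.add hv.neg

theorem ae_eq (hΩ : IsOpen Ω) (hu : HasWeakGradient Ω u G) (hv : HasWeakGradient Ω u H) :
    G =ᵐ[volume.restrict Ω] H := by
  have hGH := hu.2.1.sub hv.2.1
  have h := hΩ.ae_eq_zero_of_integral_contDiff_smul_eq_zero hGH (fun φ h1 h2 h3 => by
    have hφ : IsTestFunction Ω φ := ⟨h1, h2, h3⟩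
    refine ext_inner_left ℝ fun e => ?_
    rw [← integral_inner (hφ.integrable_smul hGH), inner_zero_right,
      ← setIntegral_eq_integral_of_eq_zero hφ.subset
      (fun x hx => by simp [IsTestFunction.eq_zero hx])]
    have e1 : ∀ x, inner ℝ e (φ x • (G - H) x) =
        φ x * inner ℝ (G x) e - φ x * inner ℝ (H x) e := fun x => by
      rw [inner_smul_right, real_inner_comm, Pi.sub_apply, inner_sub_left, mul_sub]
    simp only [e1]
    rw [integral_sub (hφ.integrable_mul_inner hu.2.1 e).restrict
      (hφ.integrable_mul_inner hv.2.1 e).restrict]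
    linarith [hu.2.2 φ hφ e, hv.2.2 φ hφ e])
  rw [Filter.EventuallyEq, ae_restrict_iff' hΩ.measurableSet]
  filter_upwards [h] with x hx hxΩ
  exact sub_eq_zero.1 (hx hxΩ)

/-- Obtained by testing the definition for `u` with `χ φ` and expanding its derivative. -/
theorem testFunction_mul (hΩ : IsOpen Ω) (hu : HasWeakGradient Ω u G) {χ : 𝔼 n → ℝ}
    (hχ : IsTestFunction Ω χ) :
    HasWeakGradient Ω (fun x => χ x * u x) (fun x => χ x • G x + u x • gradient χ x) := by
  have hl : LocallyIntegrableOn (fun x => u x • gradient χ x) Ω :=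
    hu.1.smul_continuousOn hΩ.isLocallyClosed (continuous_gradient (hχ.1.of_le (by simp))).continuousOn
  refine ⟨(hχ.integrable_smul hu.1).integrableOn.locallyIntegrableOn,
    ((hχ.integrable_smul hu.2.1).integrableOn.locallyIntegrableOn).add hl, fun φ hφ e => ?_⟩
  have h1 := hu.2.2 _ (hφ.mul hχ.1) e
  have h2 : ∀ x, u x * fderiv ℝ (fun x => χ x * φ x) x e =
      χ x * u x * fderiv ℝ φ x e + φ x * inner ℝ (u x • gradient χ x) e := fun x => by
    rw [fderiv_fun_mul (hχ.differentiable x) (hφ.differentiable x), inner_smul_left,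
      inner_gradient_eq_fderiv]
    simp
    ring
  have i1 : Integrable fun x => χ x * u x * fderiv ℝ φ x e :=
    hφ.integrable_fderiv_mul (hχ.integrable_smul hu.1).integrableOn.locallyIntegrableOn e
  have i2 := hφ.integrable_mul_inner hl e
  have i3 := hφ.integrable_mul_inner
    (hχ.integrable_smul hu.2.1).integrableOn.locallyIntegrableOn e
  simp only [h2] at h1
  rw [integral_add i1.restrict i2.restrict] at h1
  simp only [inner_add_left, mul_add]
  rw [integral_add i3.restrict i2.restrict]
  have h3 : ∀ x, χ x * φ x * inner ℝ (G x) e = φ x * inner ℝ (χ x • G x) e := fun x => by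
    rw [inner_smul_left]; simp; ring
  simp only [h3] at h1
  linarith

end HasWeakGradient

theorem contDiff_mollify (j : ℕ) {u : 𝔼 n → ℝ} (hu : Integrable u) :
    ContDiff ℝ ∞ (mollify j u) :=
  (hasCompactSupport_mollifier j).contDiff_convolution_left _ (contDiff_mollifier j)
    hu.locallyIntegrable

theorem HasWeakGradient.gradient_mollify (hΩ : IsOpen Ω) {u : 𝔼 n → ℝ} {G : 𝔼 n → 𝔼 n}
    (hu : HasWeakGradient Ω u G) {K : Set (𝔼 n)} (hK : IsCompact K) (hKΩ : K ⊆ Ω)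
    (hu0 : ∀ x ∉ K, u x = 0) (hG0 : ∀ x ∉ K, G x = 0) (j : ℕ) (x : 𝔼 n) :
    gradient (mollify j u) x = mollify j G x := by
  have hui : Integrable u := integrable_of_locallyIntegrableOn hu.1 hK hKΩ hu0
  have hGi : Integrable G := integrable_of_locallyIntegrableOn hu.2.1 hK hKΩ hG0
  -- The translate `y ↦ mollifier n j (x - y)` need not be supported in `Ω`. Multiplying by `χ`
  -- repairs this, and changes neither its values nor its derivative on `K`, outside of which `u`
  -- and `G` vanish.
  obtain ⟨χ, hχ, hχ1⟩ := exists_isTestFunction_eq_one_nhds hΩ hK hKΩ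
  refine ext_inner_right ℝ fun e => ?_
  have hη := contDiff_mollifier (n := n) j
  have hd := (hasCompactSupport_mollifier j).hasFDerivAt_convolution_left
    (ContinuousLinearMap.lsmul ℝ ℝ) (hη.of_le (by simp)) hui.locallyIntegrable x
  rw [inner_gradient_eq_fderiv, mollify, hd.fderiv]
  have hex := ((hasCompactSupport_mollifier (n := n) j).fderiv ℝ).convolutionExists_left
    ((ContinuousLinearMap.lsmul ℝ ℝ).precompL (𝔼 n)) (hη.continuous_fderiv (by simp))
    hui.locallyIntegrable x
  rw [convolution_def, ContinuousLinearMap.integral_apply hex]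
  have e1 : ∫ t, ((ContinuousLinearMap.lsmul ℝ ℝ).precompL (𝔼 n)
      (fderiv ℝ (mollifier n j) t) (u (x - t))) e =
      ∫ y, fderiv ℝ (mollifier n j) (x - y) e * u y := by
    rw [← integral_sub_left_eq_self (fun t => ((ContinuousLinearMap.lsmul ℝ ℝ).precompL (𝔼 n)
      (fderiv ℝ (mollifier n j) t) (u (x - t))) e) volume x]
    simp
  rw [e1]
  have hshift : ContDiff ℝ ∞ fun y => mollifier n j (x - y) :=
    hη.comp (contDiff_const.sub contDiff_id)
  have hθ := hχ.mul hshift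
  have h := hu.2.2 _ hθ e
  rw [setIntegral_eq_integral_of_eq_zero hKΩ (fun y hy => by simp [hu0 y hy]),
    setIntegral_eq_integral_of_eq_zero hKΩ (fun y hy => by simp [hG0 y hy])] at h
  have e2 : ∀ y, u y * fderiv ℝ (fun y => mollifier n j (x - y) * χ y) y e =
      -(fderiv ℝ (mollifier n j) (x - y) e * u y) := by
    intro y
    by_cases hy : y ∈ K
    · have heq : (fun y => mollifier n j (x - y) * χ y) =ᶠ[𝓝 y] fun y => mollifier n j (x - y) := by
        filter_upwards [hχ1 y hy] with z hz
        rw [hz, mul_one]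
      have hder : HasFDerivAt (fun y => mollifier n j (x - y))
          ((fderiv ℝ (mollifier n j) (x - y)).comp (-ContinuousLinearMap.id ℝ (𝔼 n))) y :=
        ((hη.differentiable (by simp)) (x - y)).hasFDerivAt.comp y
          ((hasFDerivAt_id y).const_sub x)
      rw [heq.fderiv_eq, hder.fderiv]
      simp
      ring
    · simp [hu0 y hy]
  have e3 : ∀ y, mollifier n j (x - y) * χ y * inner ℝ (G y) e =
      inner ℝ e (mollifier n j (x - y) • G y) := by
    intro y
    rw [inner_smul_right, real_inner_comm]
    by_cases hy : y ∈ K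
    · rw [(hχ1 y hy).self_of_nhds, mul_one]
    · simp [hG0 y hy]
  simp only [e2, e3, integral_neg, neg_inj] at h
  rw [h, integral_inner (integrable_mollifier_smul j hGi x), ← mollify_eq, real_inner_comm]

end WeakGradient

/-! ### The chain rule for weak gradients. -/

section ChainRule

variable {n : ℕ} {Ω : Set (𝔼 n)} {F : Type*} [NormedAddCommGroup F]

theorem MeasureTheory.LocallyIntegrableOn.of_norm_le {H : Type*} [NormedAddCommGroup H]
    {f : 𝔼 n → F} {g : 𝔼 n → H}
    (hg : LocallyIntegrableOn g Ω) (hf : AEStronglyMeasurable f (volume.restrict Ω))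
    (h : ∀ x, ‖f x‖ ≤ ‖g x‖) : LocallyIntegrableOn f Ω := by
  intro x hx
  obtain ⟨t, ht, hi⟩ := hg x hx
  refine ⟨t ∩ Ω, inter_mem ht self_mem_nhdsWithin, ?_⟩
  exact Integrable.mono (hi.mono_set inter_subset_left)
    (hf.mono_measure (Measure.restrict_mono inter_subset_right le_rfl))
    (Eventually.of_forall h)

/-- The case of constant exponent `1`. -/
theorem tendsto_lintegral_enorm_mollify_sub [NormedSpace ℝ F] [CompleteSpace F] (hΩ : IsOpen Ω)
    {K : Set (𝔼 n)} (hK : IsCompact K) (hKΩ : K ⊆ Ω) {f : 𝔼 n → F} (hfK : ∀ x ∉ K, f x = 0)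
    (hf : Integrable f) :
    Tendsto (fun j => ∫⁻ x in Ω, ‖mollify j f x - f x‖ₑ) atTop (𝓝 0) := by
  have h := tendsto_modular_mollify_sub (p := fun _ => 1) (pp := 1) hΩ (by simp)
    ⟨0, fun x _ y _ => by simp⟩ hK hKΩ hfK hf (by
      simp only [modular, Real.rpow_one, ofReal_norm]
      exact hf.restrict.2)
  simp only [modular, Real.rpow_one, ofReal_norm] at h
  simpa only [enorm_sub_rev] using h

theorem abs_sub_le_of_abs_deriv_le {f : ℝ → ℝ} (hf : Differentiable ℝ f) {C : ℝ}
    (hC : ∀ t, |deriv f t| ≤ C) (a b : ℝ) : |f a - f b| ≤ C * |a - b| :=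
  convex_univ.norm_image_sub_le_of_norm_deriv_le (fun x _ => hf x) (fun x _ => hC x)
    (mem_univ b) (mem_univ a)

namespace HasWeakGradient

variable {u : 𝔼 n → ℝ} {G : 𝔼 n → 𝔼 n}

theorem locallyIntegrableOn_comp (hu : HasWeakGradient Ω u G) {f : ℝ → ℝ} {C : ℝ}
    (hf : AEStronglyMeasurable (fun x => f (u x)) (volume.restrict Ω))
    (hC : ∀ t, |f t| ≤ C + C * |t|) :
    LocallyIntegrableOn (fun x => f (u x)) Ω := by
  have hg : LocallyIntegrableOn (fun x => C + C * |u x|) Ω :=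
    ((locallyIntegrable_const C).locallyIntegrableOn Ω).add (hu.1.norm.smul C)
  exact hg.of_norm_le hf fun x => (hC (u x)).trans (le_abs_self _)

theorem locallyIntegrableOn_comp_smul (hu : HasWeakGradient Ω u G) {θ : ℝ → ℝ} {C : ℝ}
    (hθ : AEStronglyMeasurable (fun x => θ (u x)) (volume.restrict Ω))
    (hC : ∀ t, |θ t| ≤ C) : LocallyIntegrableOn (fun x => θ (u x) • G x) Ω := by
  have hg : LocallyIntegrableOn (fun x => C • G x) Ω := hu.2.1.smul C
  refine hg.of_norm_le (hθ.smul hu.2.1.aestronglyMeasurable) fun x => ?_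
  rw [norm_smul, norm_smul]
  exact mul_le_mul_of_nonneg_right ((hC (u x)).trans (le_abs_self _)) (norm_nonneg _)

/-- For a fixed test function, `u` may be cut off outside a neighbourhood of its support. The
mollifications of the cut-off function obey the classical chain rule, and both sides of the
integration by parts pass to the limit. -/
theorem comp_contDiff (hΩ : IsOpen Ω) (hu : HasWeakGradient Ω u G) {f : ℝ → ℝ}
    (hf : ContDiff ℝ 1 f) {C : ℝ} (hC : ∀ t, |deriv f t| ≤ C) :
    HasWeakGradient Ω (fun x => f (u x)) (fun x => deriv f (u x) • G x) := by
  have hfd : Differentiable ℝ f := hf.differentiable (by simp)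
  have hf' : Continuous (deriv f) := hf.continuous_deriv (by simp)
  have hLip := abs_sub_le_of_abs_deriv_le hfd hC
  have hC0 : 0 ≤ C := (abs_nonneg _).trans (hC 0)
  have hum := hu.1.aestronglyMeasurable
  refine ⟨hu.locallyIntegrableOn_comp (C := |f 0| + C) (hf.continuous.comp_aestronglyMeasurable hum)
      fun t => ?_,
    hu.locallyIntegrableOn_comp_smul (hf'.comp_aestronglyMeasurable hum) hC, fun ψ hψ e => ?_⟩
  · have h1 := hLip t 0
    rw [sub_zero] at h1
    have h2 := abs_sub_abs_le_abs_sub (f t) (f 0)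
    nlinarith [mul_nonneg (abs_nonneg (f 0)) (abs_nonneg t)]
  obtain ⟨χ, hχ, hχ1⟩ := exists_isTestFunction_eq_one_nhds hΩ hψ.isCompact hψ.subset
  set s : 𝔼 n → ℝ := fun x => χ x * u x with hs
  set H : 𝔼 n → 𝔼 n := fun x => χ x • G x + u x • gradient χ x with hH
  have hsH : HasWeakGradient Ω s H := hu.testFunction_mul hΩ hχ
  have hs0 : ∀ x ∉ tsupport χ, s x = 0 := fun x hx => by
    simp [hs, IsTestFunction.eq_zero hx]
  have hH0 : ∀ x ∉ tsupport χ, H x = 0 := fun x hx => by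
    simp [hH, IsTestFunction.eq_zero hx, IsTestFunction.gradient_eq_zero hx]
  have hsi : Integrable s := integrable_of_locallyIntegrableOn hsH.1 hχ.isCompact hχ.subset hs0
  have hHi : Integrable H := integrable_of_locallyIntegrableOn hsH.2.1 hχ.isCompact hχ.subset hH0
  have hsu : ∀ x ∈ tsupport ψ, s x = u x := fun x hx => by
    simp [hs, (hχ1 x hx).self_of_nhds]
  have hHG : ∀ x ∈ tsupport ψ, H x = G x := fun x hx => by
    have hg : gradient χ x = 0 := by
      have h : χ =ᶠ[𝓝 x] fun _ => 1 := hχ1 x hx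
      rw [gradient, h.fderiv_eq]
      simp
    simp [hH, (hχ1 x hx).self_of_nhds, hg]
  have e1 : ∫ x in Ω, f (u x) * fderiv ℝ ψ x e = ∫ x in Ω, f (s x) * fderiv ℝ ψ x e := by
    congr 1; funext x
    by_cases hx : x ∈ tsupport ψ
    · rw [hsu x hx]
    · simp [IsTestFunction.fderiv_eq_zero hx]
  have e2 : ∫ x in Ω, ψ x * inner ℝ (deriv f (u x) • G x) e =
      ∫ x in Ω, ψ x * (deriv f (s x) * inner ℝ (H x) e) := by
    congr 1; funext x
    by_cases hx : x ∈ tsupport ψ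
    · rw [hsu x hx, hHG x hx, inner_smul_left]; rfl
    · simp [IsTestFunction.eq_zero hx]
  rw [e1, e2]
  have hsj : ∀ j, ContDiff ℝ 1 (mollify j s) := fun j => (contDiff_mollify j hsi).of_le (by simp)
  have hcomp : ∀ j, ContDiff ℝ 1 fun x => f (mollify j s x) := fun j => hf.comp (hsj j)
  have hgrad : ∀ j x, inner ℝ (gradient (fun x => f (mollify j s x)) x) e =
      deriv f (mollify j s x) * inner ℝ (mollify j H x) e := by
    intro j x
    rw [inner_gradient_eq_fderiv, ← hsH.gradient_mollify hΩ hχ.isCompact hχ.subset hs0 hH0 j x,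
      inner_gradient_eq_fderiv]
    have hd : HasFDerivAt (fun x => f (mollify j s x))
        (deriv f (mollify j s x) • fderiv ℝ (mollify j s) x) x :=
      (hfd (mollify j s x)).hasDerivAt.comp_hasFDerivAt x
        ((hsj j).differentiable (by simp) x).hasFDerivAt
    rw [hd.fderiv]
    simp
  have hj : ∀ j, ∫ x in Ω, f (mollify j s x) * fderiv ℝ ψ x e =
      -∫ x in Ω, ψ x * (deriv f (mollify j s x) * inner ℝ (mollify j H x) e) := by
    intro j
    rw [((hcomp j).hasWeakGradient (Ω := Ω)).2.2 ψ hψ e]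
    simp only [hgrad]
  obtain ⟨B, hB⟩ : ∃ B, ∀ x, ‖fderiv ℝ ψ x e‖ ≤ B := by
    refine (hψ.continuous_fderiv_apply e).bounded_above_of_compact_support ?_
    exact HasCompactSupport.intro hψ.isCompact fun x hx => by
      simp [IsTestFunction.fderiv_eq_zero hx]
  obtain ⟨B', hB'⟩ : ∃ B, ∀ x, ‖ψ x‖ ≤ B :=
    hψ.continuous.bounded_above_of_compact_support hψ.2.1
  have hB'0 : 0 ≤ B' := (norm_nonneg _).trans (hB' 0)
  have hlim1 : Tendsto (fun j => ∫ x in Ω, f (mollify j s x) * fderiv ℝ ψ x e) atTop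
      (𝓝 (∫ x in Ω, f (s x) * fderiv ℝ ψ x e)) := by
    have hL : LocallyIntegrableOn (fun x => f (s x)) Ω := by
      refine hsH.locallyIntegrableOn_comp (C := |f 0| + C)
        (hf.continuous.comp_aestronglyMeasurable hsH.1.aestronglyMeasurable) fun t => ?_
      have h1 := hLip t 0
      rw [sub_zero] at h1
      have h2 := abs_sub_abs_le_abs_sub (f t) (f 0)
      nlinarith [mul_nonneg (abs_nonneg (f 0)) (abs_nonneg t)]
    refine tendsto_integral_of_L1 _ (hψ.integrable_fderiv_mul hL e).restrict.aestronglyMeasurable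
      (Eventually.of_forall fun j => (hψ.integrable_fderiv_mul
        ((hcomp j).hasWeakGradient (Ω := Ω)).1 e).restrict) ?_
    have h0 := ENNReal.Tendsto.const_mul (a := ENNReal.ofReal (C * B))
      (tendsto_lintegral_enorm_mollify_sub hΩ hχ.isCompact hχ.subset hs0 hsi)
      (Or.inr ENNReal.ofReal_ne_top)
    rw [mul_zero] at h0
    refine tendsto_of_tendsto_of_tendsto_of_le_of_le tendsto_const_nhds h0
      (fun _ => zero_le) fun j => ?_
    simp only
    rw [← lintegral_const_mul' _ _ ENNReal.ofReal_ne_top]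
    refine lintegral_mono fun x => ?_
    rw [← ofReal_norm, ← ofReal_norm, ← ENNReal.ofReal_mul
      (mul_nonneg hC0 ((norm_nonneg _).trans (hB 0)))]
    refine ENNReal.ofReal_le_ofReal ?_
    rw [← sub_mul, norm_mul]
    calc _ ≤ (C * ‖mollify j s x - s x‖) * B :=
          mul_le_mul (hLip _ _) (hB x) (norm_nonneg _) (by positivity)
      _ = _ := by ring
  have hlim2 : Tendsto (fun j => ∫ x in Ω, ψ x * (deriv f (mollify j s x) *
      inner ℝ (mollify j H x) e)) atTop
      (𝓝 (∫ x in Ω, ψ x * (deriv f (s x) * inner ℝ (H x) e))) := by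
    have hi : ∀ j, Integrable fun x => ψ x * (deriv f (mollify j s x) *
        inner ℝ (mollify j H x) e) := fun j => by
      simpa only [hgrad] using hψ.integrable_mul_inner
        ((hcomp j).hasWeakGradient (Ω := Ω)).2.1 e
    have hi' : Integrable fun x => ψ x * (deriv f (s x) * inner ℝ (H x) e) := by
      have := hψ.integrable_mul_inner (hsH.locallyIntegrableOn_comp_smul
        (hf'.comp_aestronglyMeasurable hsH.1.aestronglyMeasurable) hC) e
      simpa [inner_smul_left] using this
    refine tendsto_integral_of_L1 _ hi'.restrict.aestronglyMeasurable
      (Eventually.of_forall fun j => (hi j).restrict) ?_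
    have h0 := ENNReal.Tendsto.const_mul (a := ENNReal.ofReal (B' * C * ‖e‖))
      (tendsto_lintegral_enorm_mollify_sub hΩ hχ.isCompact hχ.subset hH0 hHi)
      (Or.inr ENNReal.ofReal_ne_top)
    have hd : Tendsto (fun j => ∫⁻ x in Ω, ENNReal.ofReal
        (|deriv f (mollify j s x) - deriv f (s x)| * (B' * ‖e‖ * ‖H x‖))) atTop
        (𝓝 (∫⁻ _ in Ω, (0 : ℝ≥0∞))) := by
      refine tendsto_lintegral_of_dominated_convergence'
        (fun x => ENNReal.ofReal (2 * C * (B' * ‖e‖ * ‖H x‖))) (fun j => ?_) (fun j => ?_) ?_ ?_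
      · refine AEMeasurable.ennreal_ofReal (AEStronglyMeasurable.aemeasurable ?_)
        refine AEStronglyMeasurable.mul ?_ (hHi.norm.const_mul _).aestronglyMeasurable.restrict
        exact ((hf'.comp (hsj j).continuous).aestronglyMeasurable.sub
          (hf'.comp_aestronglyMeasurable hsH.1.aestronglyMeasurable)).norm
      · refine Eventually.of_forall fun x => ENNReal.ofReal_le_ofReal ?_
        refine mul_le_mul_of_nonneg_right ?_ (by positivity)
        have := abs_sub (deriv f (mollify j s x)) (deriv f (s x))
        linarith [hC (mollify j s x), hC (s x)]
      · exact (((hHi.norm.const_mul (B' * ‖e‖)).const_mul (2 * C)).restrict).lintegral_lt_top.ne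
      · filter_upwards [ae_restrict_of_ae (ae_tendsto_mollify hsi)] with x hx
        rw [← ENNReal.ofReal_zero]
        refine ENNReal.tendsto_ofReal ?_
        have h1 : Tendsto (fun j => deriv f (mollify j s x)) atTop (𝓝 (deriv f (s x))) :=
          (hf'.tendsto _).comp hx
        have h2 := ((h1.sub_const (deriv f (s x))).abs).mul_const (B' * ‖e‖ * ‖H x‖)
        simpa using h2
    rw [lintegral_zero] at hd
    have hsum := h0.add hd
    rw [mul_zero, add_zero] at hsum
    refine tendsto_of_tendsto_of_tendsto_of_le_of_le tendsto_const_nhds hsum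
      (fun _ => zero_le) fun j => ?_
    simp only
    have hm : AEMeasurable (fun x => ENNReal.ofReal (B' * C * ‖e‖) * ‖mollify j H x - H x‖ₑ)
        (volume.restrict Ω) := ((integrable_mollify j
          hHi).sub hHi).aestronglyMeasurable.restrict.enorm.const_mul _
    rw [← lintegral_const_mul' _ _ ENNReal.ofReal_ne_top, ← lintegral_add_left' hm]
    refine lintegral_mono fun x => ?_
    rw [← ofReal_norm, ← ofReal_norm, ← ENNReal.ofReal_mul (by positivity),
      ← ENNReal.ofReal_add (by positivity) (by positivity)]
    refine ENNReal.ofReal_le_ofReal ?_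
    -- The first term is controlled by `L¹` convergence of the mollified gradients and the bound on
    -- `f'`. The second contains only the fixed gradient `H` and is handled by dominated
    -- convergence, using `mollify j s → s` a.e.
    have hsplit : ψ x * (deriv f (mollify j s x) * inner ℝ (mollify j H x) e) -
        ψ x * (deriv f (s x) * inner ℝ (H x) e) =
        ψ x * (deriv f (mollify j s x) * inner ℝ (mollify j H x - H x) e) +
        ψ x * ((deriv f (mollify j s x) - deriv f (s x)) * inner ℝ (H x) e) := by
      rw [inner_sub_left]; ring
    rw [hsplit]
    refine (norm_add_le _ _).trans (add_le_add ?_ ?_)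
    · rw [norm_mul, norm_mul]
      calc _ ≤ B' * (C * (‖mollify j H x - H x‖ * ‖e‖)) := by
            gcongr
            · exact hB' x
            · exact hC _
            · exact norm_inner_le_norm _ _
        _ = _ := by ring
    · rw [norm_mul, norm_mul]
      calc _ ≤ B' * (|deriv f (mollify j s x) - deriv f (s x)| * (‖H x‖ * ‖e‖)) := by
            gcongr
            · exact hB' x
            · exact le_rfl
            · exact norm_inner_le_norm _ _
        _ = _ := by ring
  simp only [hj] at hlim1
  exact tendsto_nhds_unique hlim1 hlim2.neg

/-- Extends the chain rule to nonsmooth `Φ` by dominated convergence. The derivatives must converge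
at every point, since `u` may take a single value on a set of positive measure. -/
theorem comp_of_tendsto (hΩ : IsOpen Ω) (hu : HasWeakGradient Ω u G) {f : ℕ → ℝ → ℝ}
    {Φ θ : ℝ → ℝ} (hf : ∀ k, ContDiff ℝ 1 (f k)) {C : ℝ} (hC : ∀ k t, |deriv (f k) t| ≤ C)
    (hC0 : ∀ k, |f k 0| ≤ C) (hΦ : ∀ t, Tendsto (fun k => f k t) atTop (𝓝 (Φ t)))
    (hθ : ∀ t, Tendsto (fun k => deriv (f k) t) atTop (𝓝 (θ t))) :
    HasWeakGradient Ω (fun x => Φ (u x)) (fun x => θ (u x) • G x) := by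
  have hum := hu.1.aestronglyMeasurable
  have hk := fun k => hu.comp_contDiff hΩ (hf k) (hC k)
  have hCC : ∀ k t, |f k t| ≤ C + C * |t| := fun k t => by
    have h1 := abs_sub_le_of_abs_deriv_le ((hf k).differentiable (by simp)) (hC k) t 0
    rw [sub_zero] at h1
    linarith [abs_sub_abs_le_abs_sub (f k t) (f k 0), hC0 k]
  have hΦm : AEStronglyMeasurable (fun x => Φ (u x)) (volume.restrict Ω) :=
    aestronglyMeasurable_of_tendsto_ae atTop (fun k => (hk k).1.aestronglyMeasurable)
      (Eventually.of_forall fun x => hΦ (u x))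
  have hθm : AEStronglyMeasurable (fun x => θ (u x)) (volume.restrict Ω) :=
    aestronglyMeasurable_of_tendsto_ae atTop
      (fun k => ((hf k).continuous_deriv (by simp)).comp_aestronglyMeasurable hum)
      (Eventually.of_forall fun x => hθ (u x))
  have hΦC : ∀ t, |Φ t| ≤ C + C * |t| := fun t =>
    le_of_tendsto (hΦ t).abs (Eventually.of_forall fun k => hCC k t)
  have hθC : ∀ t, |θ t| ≤ C := fun t =>
    le_of_tendsto (hθ t).abs (Eventually.of_forall fun k => hC k t)
  refine ⟨hu.locallyIntegrableOn_comp hΦm hΦC, hu.locallyIntegrableOn_comp_smul hθm hθC,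
    fun φ hφ e => ?_⟩
  have hlim1 : Tendsto (fun k => ∫ x in Ω, f k (u x) * fderiv ℝ φ x e) atTop
      (𝓝 (∫ x in Ω, Φ (u x) * fderiv ℝ φ x e)) := by
    have hb : LocallyIntegrableOn (fun x => C + C * |u x|) Ω :=
      ((locallyIntegrable_const C).locallyIntegrableOn Ω).add (hu.1.norm.smul C)
    refine tendsto_integral_of_dominated_convergence
      (fun x => ‖(C + C * |u x|) * fderiv ℝ φ x e‖)
      (fun k => (hφ.integrable_fderiv_mul (hk k).1 e).restrict.aestronglyMeasurable)
      (hφ.integrable_fderiv_mul hb e).restrict.norm (fun k => ?_) ?_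
    · refine Eventually.of_forall fun x => ?_
      rw [norm_mul, norm_mul]
      exact mul_le_mul_of_nonneg_right ((hCC k _).trans (le_abs_self _)) (norm_nonneg _)
    · exact Eventually.of_forall fun x => (hΦ (u x)).mul_const _
  have hlim2 : Tendsto (fun k => ∫ x in Ω, φ x * inner ℝ (deriv (f k) (u x) • G x) e) atTop
      (𝓝 (∫ x in Ω, φ x * inner ℝ (θ (u x) • G x) e)) := by
    refine tendsto_integral_of_dominated_convergence
      (fun x => C * ‖φ x * inner ℝ (G x) e‖)
      (fun k => (hφ.integrable_mul_inner (hk k).2.1 e).restrict.aestronglyMeasurable)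
      ((hφ.integrable_mul_inner hu.2.1 e).restrict.norm.const_mul C) (fun k => ?_) ?_
    · refine Eventually.of_forall fun x => ?_
      rw [inner_smul_left, mul_left_comm, norm_mul]
      exact mul_le_mul_of_nonneg_right (hC k _) (norm_nonneg _)
    · refine Eventually.of_forall fun x => ?_
      simp only [inner_smul_left]
      exact ((hθ (u x)).mul_const _).const_mul _
  have hkk := fun k => (hk k).2.2 φ hφ e
  simp only [hkk] at hlim1
  exact tendsto_nhds_unique hlim1 hlim2.neg

end HasWeakGradient

end ChainRule

/-! ### The positive part of a Sobolev function. -/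

section PosPart

/-- A smooth approximation of `max t 0` whose derivative tends to `1` for `t > 0` and to `0` for
`t ≤ 0` as `δ → 0`. -/
noncomputable def smoothPosPart (δ t : ℝ) : ℝ :=
  (t + √(t ^ 2 + δ ^ 2)) / 2 - δ / 2 * Real.arctan (t / δ)

variable {δ : ℝ}

theorem contDiff_smoothPosPart (hδ : 0 < δ) : ContDiff ℝ 1 (smoothPosPart δ) := by
  unfold smoothPosPart
  refine ContDiff.sub (ContDiff.div_const (contDiff_id.add (ContDiff.sqrt (by fun_prop) fun t =>
    ?_)) _) (contDiff_const.mul (ContDiff.arctan (by fun_prop)))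
  positivity

theorem deriv_smoothPosPart (hδ : 0 < δ) (t : ℝ) : deriv (smoothPosPart δ) t =
    (1 + t / √(t ^ 2 + δ ^ 2)) / 2 - δ ^ 2 / (t ^ 2 + δ ^ 2) / 2 := by
  have h0 : t ^ 2 + δ ^ 2 ≠ 0 := by positivity
  have h1 : HasDerivAt (fun t : ℝ => √(t ^ 2 + δ ^ 2)) (2 * t / (2 * √(t ^ 2 + δ ^ 2))) t := by
    have h := (((hasDerivAt_pow 2 t).add_const (δ ^ 2)).sqrt h0)
    simpa using h
  have h2 : HasDerivAt (fun t : ℝ => Real.arctan (t / δ)) (1 / (1 + (t / δ) ^ 2) * (1 / δ)) t :=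
    ((hasDerivAt_id t).div_const δ).arctan
  have h3 := (((hasDerivAt_id t).add h1).div_const 2).sub (h2.const_mul (δ / 2))
  refine HasDerivAt.deriv (h3.congr_deriv ?_)
  have hs : 0 < √(t ^ 2 + δ ^ 2) := by positivity
  field_simp
  ring

theorem abs_deriv_smoothPosPart_le (hδ : 0 < δ) (t : ℝ) : |deriv (smoothPosPart δ) t| ≤ 2 := by
  rw [deriv_smoothPosPart hδ]
  have hs : 0 < √(t ^ 2 + δ ^ 2) := by positivity
  have h1 : |t / √(t ^ 2 + δ ^ 2)| ≤ 1 := by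
    rw [abs_div, abs_of_pos hs, div_le_one hs]
    exact Real.abs_le_sqrt (by nlinarith)
  have h2 : δ ^ 2 / (t ^ 2 + δ ^ 2) ≤ 1 := by
    rw [div_le_one (by positivity)]; nlinarith
  have h3 : 0 ≤ δ ^ 2 / (t ^ 2 + δ ^ 2) := by positivity
  rw [abs_le] at h1 ⊢
  constructor <;> linarith [h1.1, h1.2]

theorem tendsto_smoothPosPart (t : ℝ) :
    Tendsto (fun k : ℕ => smoothPosPart (1 / ((k : ℝ) + 1)) t) atTop (𝓝 (max t 0)) := by
  have hδ : Tendsto (fun k : ℕ => 1 / ((k : ℝ) + 1)) atTop (𝓝 0) :=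
    tendsto_one_div_add_atTop_nhds_zero_nat
  have h1 : Tendsto (fun k : ℕ => √(t ^ 2 + (1 / ((k : ℝ) + 1)) ^ 2)) atTop (𝓝 |t|) := by
    have := ((hδ.pow 2).const_add (t ^ 2)).sqrt
    simpa [Real.sqrt_sq_eq_abs] using this
  have h2 : Tendsto (fun k : ℕ => 1 / ((k : ℝ) + 1) / 2 * Real.arctan (t / (1 / ((k : ℝ) + 1))))
      atTop (𝓝 0) := by
    refine Tendsto.zero_mul_isBoundedUnder_le (by simpa using hδ.div_const 2) ?_
    refine isBoundedUnder_of ⟨Real.pi / 2, fun k => ?_⟩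
    simp only [Function.comp, Real.norm_eq_abs, abs_le]
    exact ⟨(Real.neg_pi_div_two_lt_arctan _).le, (Real.arctan_lt_pi_div_two _).le⟩
  have h3 := ((h1.const_add t).div_const 2).sub h2
  have e : max t 0 = (t + |t|) / 2 - 0 := by
    rcases le_total t 0 with h | h
    · rw [max_eq_right h, abs_of_nonpos h]; ring
    · rw [max_eq_left h, abs_of_nonneg h]; ring
  rw [e]
  exact h3

/-- The arctangent term makes the derivative at `t = 0` vanish for every `δ`. Without it the limit
there would be `1 / 2`, and no information on the gradient over the zero set could be extracted. -/
theorem tendsto_deriv_smoothPosPart (t : ℝ) :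
    Tendsto (fun k : ℕ => deriv (smoothPosPart (1 / ((k : ℝ) + 1))) t) atTop
      (𝓝 (if 0 < t then 1 else 0)) := by
  have hpos : ∀ k : ℕ, 0 < 1 / ((k : ℝ) + 1) := fun k => by positivity
  simp only [deriv_smoothPosPart (hpos _)]
  rcases eq_or_ne t 0 with rfl | ht
  · have : ∀ k : ℕ, (1 + 0 / √((0 : ℝ) ^ 2 + (1 / ((k : ℝ) + 1)) ^ 2)) / 2 -
        (1 / ((k : ℝ) + 1)) ^ 2 / (0 ^ 2 + (1 / ((k : ℝ) + 1)) ^ 2) / 2 = 0 := fun k => by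
      have := hpos k
      have h2 : (1 / ((k : ℝ) + 1)) ^ 2 ≠ 0 := by positivity
      rw [zero_div, zero_pow two_ne_zero, zero_add, div_self h2]
      norm_num
    simp only [this, lt_irrefl, if_false]
    exact tendsto_const_nhds
  · have hδ : Tendsto (fun k : ℕ => 1 / ((k : ℝ) + 1)) atTop (𝓝 0) :=
      tendsto_one_div_add_atTop_nhds_zero_nat
    have hsq := (hδ.pow 2).const_add (t ^ 2)
    rw [zero_pow two_ne_zero, add_zero] at hsq
    have h1 := hsq.sqrt
    rw [Real.sqrt_sq_eq_abs] at h1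
    have h2 := (((tendsto_const_nhds (x := t)).div h1 (abs_ne_zero.2 ht)).const_add 1).div_const 2
    have h3 := (((hδ.pow 2).div hsq (pow_ne_zero 2 ht))).div_const 2
    have h4 := h2.sub h3
    have e : (if 0 < t then (1 : ℝ) else 0) = (1 + t / |t|) / 2 - 0 ^ 2 / t ^ 2 / 2 := by
      rcases ht.lt_or_gt with h | h
      · rw [if_neg h.not_gt, abs_of_neg h, div_neg, div_self ht]; norm_num
      · rw [if_pos h, abs_of_pos h, div_self ht]; norm_num
    rw [e]
    exact h4

variable {n : ℕ} {Ω : Set (𝔼 n)} {u : 𝔼 n → ℝ} {G : 𝔼 n → 𝔼 n}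

theorem HasWeakGradient.posPart (hΩ : IsOpen Ω) (hu : HasWeakGradient Ω u G) :
    HasWeakGradient Ω (fun x => max (u x) 0) (fun x => (if 0 < u x then (1 : ℝ) else 0) • G x) := by
  have hpos : ∀ k : ℕ, 0 < 1 / ((k : ℝ) + 1) := fun k => by positivity
  refine hu.comp_of_tendsto hΩ (C := 2) (Φ := fun t => max t 0)
    (θ := fun t => if 0 < t then 1 else 0)
    (fun k => contDiff_smoothPosPart (hpos k)) (fun k => abs_deriv_smoothPosPart_le (hpos k))
    (fun k => ?_) tendsto_smoothPosPart tendsto_deriv_smoothPosPart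
  have h1 : 1 / ((k : ℝ) + 1) ≤ 1 := by
    rw [div_le_one (by positivity)]; simp
  have h2 := (hpos k).le
  rw [smoothPosPart, zero_pow two_ne_zero, zero_add, zero_add, Real.sqrt_sq h2, zero_div,
    Real.arctan_zero, mul_zero, sub_zero, abs_of_nonneg (by positivity)]
  linarith

/-- A weak gradient vanishes almost everywhere on the zero set of the function. -/
theorem HasWeakGradient.ae_eq_zero_of_eq_zero (hΩ : IsOpen Ω) (hu : HasWeakGradient Ω u G) :
    ∀ᵐ x ∂volume.restrict Ω, u x = 0 → G x = 0 := by
  have h := (hu.posPart hΩ).sub (hu.neg.posPart hΩ)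
  -- The gradients given for `u⁺` and `(-u)⁺` both vanish on `{u = 0}`. Their difference is a weak
  -- gradient of `u`, so uniqueness carries this over to `G`.
  have e : (fun x => max (u x) 0 - max (-u x) 0) = u := by
    funext x
    exact max_zero_sub_max_neg_zero_eq_self (u x)
  rw [e] at h
  filter_upwards [hu.ae_eq hΩ h] with x hx h0
  rw [hx]
  simp [h0]

end PosPart

/-! ### The closure of the test functions and truncation. -/

section SobolevZero

variable {n : ℕ} {p : 𝔼 n → ℝ} {Ω : Set (𝔼 n)} {pp : ℝ} {u v : 𝔼 n → ℝ} {G H : 𝔼 n → 𝔼 n}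

theorem gradient_add_fun {φ χ : 𝔼 n → ℝ} (hφ : Differentiable ℝ φ) (hχ : Differentiable ℝ χ)
    (x : 𝔼 n) : gradient (fun x => φ x + χ x) x = gradient φ x + gradient χ x := by
  simp [gradient, fderiv_fun_add (hφ x) (hχ x)]

theorem gradient_neg_fun (φ : 𝔼 n → ℝ) (x : 𝔼 n) :
    gradient (fun x => -φ x) x = -gradient φ x := by
  simp [gradient, fderiv_fun_neg]

theorem IsTestFunction.continuous_gradient {φ : 𝔼 n → ℝ} (hφ : IsTestFunction Ω φ) :
    Continuous (gradient φ) :=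
  _root_.continuous_gradient (hφ.1.of_le (by simp))

/-- A compactly supported Sobolev function is approximated by its mollifications. -/
theorem modularApprox_of_isCompact (hΩ : IsOpen Ω) (hp : ∀ x ∈ Ω, 1 ≤ p x ∧ p x ≤ pp)
    (hpLip : ∃ K, LipschitzOnWith K p Ω) {K : Set (𝔼 n)} (hK : IsCompact K) (hKΩ : K ⊆ Ω)
    (hu : HasWeakGradient Ω u G) (hu0 : ∀ x ∉ K, u x = 0) (hG0 : ∀ x ∉ K, G x = 0)
    (hum : modular p Ω u < ⊤) (hGm : modular p Ω G < ⊤) : ModularApprox p Ω u G := by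
  intro ε hε
  have hui : Integrable u := integrable_of_locallyIntegrableOn hu.1 hK hKΩ hu0
  have hGi : Integrable G := integrable_of_locallyIntegrableOn hu.2.1 hK hKΩ hG0
  have hε' : (0 : ℝ≥0∞) < ENNReal.ofReal ε := by simpa using hε
  obtain ⟨δ, hδ, hδΩ⟩ := hK.exists_cthickening_subset_open hΩ hKΩ
  have h1 := (tendsto_modular_mollify_sub hΩ hp hpLip hK hKΩ hu0 hui hum).eventually_le_const hε'
  have h2 := (tendsto_modular_mollify_sub hΩ hp hpLip hK hKΩ hG0 hGi hGm).eventually_le_const hε'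
  have h3 := (tendsto_one_div_add_atTop_nhds_zero_nat (𝕜 := ℝ)).eventually_le_const hδ
  obtain ⟨j, hj1, hj2, hj3⟩ := (h1.and (h2.and h3)).exists
  have hsupp : tsupport (mollify j u) ⊆ Metric.cthickening δ K := by
    refine closure_minimal (fun x hx => ?_) Metric.isClosed_cthickening
    by_contra hcon
    exact hx (mollify_eq_zero hu0 fun h => hcon (Metric.cthickening_mono hj3 K h))
  refine ⟨mollify j u, ⟨contDiff_mollify j hui,
    hK.cthickening.of_isClosed_subset (isClosed_tsupport _) hsupp, hsupp.trans hδΩ⟩, hj1, ?_⟩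
  simpa only [hu.gradient_mollify hΩ hK hKΩ hu0 hG0] using hj2

theorem ModularApprox.neg (h : ModularApprox p Ω u G) :
    ModularApprox p Ω (fun x => -u x) (fun x => -G x) := by
  intro ε hε
  obtain ⟨φ, hφ, h1, h2⟩ := h ε hε
  refine ⟨fun x => -φ x, hφ.neg, ?_, ?_⟩
  · rw [← modular_neg]; simpa [sub_eq_add_neg, add_comm] using h1
  · rw [← modular_neg]; simpa [sub_eq_add_neg, add_comm, gradient_neg_fun] using h2

theorem exists_two_rpow_mul_le (pp : ℝ) {ε : ℝ} (hε : 0 < ε) :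
    ∃ δ : ℝ, 0 < δ ∧ ENNReal.ofReal (2 ^ pp) * (ENNReal.ofReal δ + ENNReal.ofReal δ) ≤
      ENNReal.ofReal ε := by
  refine ⟨ε / (2 * 2 ^ pp), by positivity, ?_⟩
  rw [← ENNReal.ofReal_add (by positivity) (by positivity), ← ENNReal.ofReal_mul (by positivity)]
  refine ENNReal.ofReal_le_ofReal (le_of_eq ?_)
  field_simp
  norm_num

theorem ModularApprox.add (hΩ : MeasurableSet Ω) (hpc : ContinuousOn p Ω)
    (hp : ∀ x ∈ Ω, 0 ≤ p x ∧ p x ≤ pp) (hu : AEStronglyMeasurable u (volume.restrict Ω))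
    (hG : AEStronglyMeasurable G (volume.restrict Ω))
    (h : ModularApprox p Ω u G) (h' : ModularApprox p Ω v H) :
    ModularApprox p Ω (fun x => u x + v x) (fun x => G x + H x) := by
  intro ε hε
  obtain ⟨δ, hδ, hle⟩ := exists_two_rpow_mul_le pp hε
  obtain ⟨φ, hφ, h1, h2⟩ := h δ hδ
  obtain ⟨χ, hχ, h3, h4⟩ := h' δ hδ
  refine ⟨fun x => φ x + χ x, hφ.add hχ, ?_, ?_⟩
  · simp only [add_sub_add_comm]
    refine (modular_add_le hΩ hpc hp (hu.sub hφ.continuous.aestronglyMeasurable)).trans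
      (le_trans ?_ hle)
    gcongr
    exact h1
  · simp only [gradient_add_fun hφ.differentiable hχ.differentiable, add_sub_add_comm]
    refine (modular_add_le hΩ hpc hp
      (hG.sub hφ.continuous_gradient.aestronglyMeasurable)).trans (le_trans ?_ hle)
    gcongr
    exact h2

/-- A limit of limits of test functions is again a limit of test functions. -/
theorem ModularApprox.of_forall_exists (hΩ : MeasurableSet Ω) (hpc : ContinuousOn p Ω)
    (hp : ∀ x ∈ Ω, 0 ≤ p x ∧ p x ≤ pp) (hu : AEStronglyMeasurable u (volume.restrict Ω))
    (hG : AEStronglyMeasurable G (volume.restrict Ω))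
    (h : ∀ ε : ℝ, 0 < ε → ∃ v H, ModularApprox p Ω v H ∧
      AEStronglyMeasurable v (volume.restrict Ω) ∧ AEStronglyMeasurable H (volume.restrict Ω) ∧
      modular p Ω (fun x => u x - v x) ≤ ENNReal.ofReal ε ∧
      modular p Ω (fun x => G x - H x) ≤ ENNReal.ofReal ε) :
    ModularApprox p Ω u G := by
  intro ε hε
  obtain ⟨δ, hδ, hle⟩ := exists_two_rpow_mul_le pp hε
  obtain ⟨v, H, hvH, hv, hH, h1, h2⟩ := h δ hδ
  obtain ⟨φ, hφ, h3, h4⟩ := hvH δ hδ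
  refine ⟨φ, hφ, ?_, ?_⟩
  · have e : (fun x => u x - φ x) = fun x => (u x - v x) + (v x - φ x) := by funext x; ring
    rw [e]
    refine (modular_add_le hΩ hpc hp (hu.sub hv)).trans (le_trans ?_ hle)
    gcongr
    exact h1
  · have e : (fun x => G x - gradient φ x) = fun x => (G x - H x) + (H x - gradient φ x) := by
      funext x; abel
    rw [e]
    refine (modular_add_le hΩ hpc hp (hG.sub hH)).trans (le_trans ?_ hle)
    gcongr
    exact h2

/-- The series of `|f j x| ^ p x` has finite integral, so it converges for almost every `x` and its
terms tend to zero. -/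
theorem ae_tendsto_of_tsum_modular_ne_top (hΩ : MeasurableSet Ω) (hpc : ContinuousOn p Ω)
    (hp : ∀ x ∈ Ω, 0 < p x) {f : ℕ → 𝔼 n → ℝ}
    (hf : ∀ j, AEStronglyMeasurable (f j) (volume.restrict Ω))
    (h : ∑' j, modular p Ω (f j) ≠ ⊤) :
    ∀ᵐ x ∂volume.restrict Ω, Tendsto (fun j => f j x) atTop (𝓝 0) := by
  have hm := fun j => aemeasurable_ofReal_norm_rpow hΩ hpc (hf j)
  simp only [modular] at h
  rw [← lintegral_tsum hm] at h
  filter_upwards [ae_lt_top' (AEMeasurable.tsum hm) h, ae_restrict_mem hΩ] with x hx hxΩ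
  have h0 := ENNReal.tendsto_atTop_zero_of_tsum_ne_top hx.ne
  have h1 : Tendsto (fun j => ‖f j x‖ ^ p x) atTop (𝓝 0) := by
    have h2 := (ENNReal.tendsto_toReal ENNReal.zero_ne_top).comp h0
    simp only [ENNReal.toReal_zero] at h2
    refine h2.congr fun j => ?_
    simp only [Function.comp]
    exact ENNReal.toReal_ofReal (by positivity)
  have hpx := hp x hxΩ
  have h3 := h1.rpow_const (p := (p x)⁻¹) (Or.inr (by positivity))
  rw [Real.zero_rpow (by positivity)] at h3
  rw [tendsto_zero_iff_norm_tendsto_zero]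
  refine h3.congr fun j => ?_
  rw [← Real.rpow_mul (norm_nonneg _), mul_inv_cancel₀ hpx.ne', Real.rpow_one]

/-- If `s ≤ k` with `s` in the Sobolev space and `k` in the closure of the test functions, then the
positive part of `s` lies in the closure of the test functions. -/
theorem ModularApprox.posPart_of_le (hΩ : IsOpen Ω) (hp : ∀ x ∈ Ω, 1 ≤ p x ∧ p x ≤ pp)
    (hpLip : ∃ K, LipschitzOnWith K p Ω) {k s : 𝔼 n → ℝ} {Gk Gs : 𝔼 n → 𝔼 n}
    (hk : HasWeakGradient Ω k Gk) (hka : ModularApprox p Ω k Gk)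
    (hs : HasWeakGradient Ω s Gs) (hsm : modular p Ω s < ⊤) (hGsm : modular p Ω Gs < ⊤)
    (hle : ∀ x, s x ≤ k x) :
    ModularApprox p Ω (fun x => max (s x) 0)
      (fun x => (if 0 < s x then (1 : ℝ) else 0) • Gs x) := by
  have hpc : ContinuousOn p Ω := hpLip.choose_spec.continuousOn
  have hΩm := hΩ.measurableSet
  have hp0 : ∀ x ∈ Ω, 0 ≤ p x ∧ p x ≤ pp := fun x hx =>
    ⟨by linarith [(hp x hx).1], (hp x hx).2⟩
  -- The geometric rate makes the modulars summable, which yields a.e. convergence without passing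
  -- to a subsequence.
  choose φ hφ hφ1 hφ2 using fun j : ℕ => hka ((1 / 2 : ℝ) ^ j) (by positivity)
  set θ : ℝ → ℝ := fun t => if 0 < t then 1 else 0 with hθ
  have hθ01 : ∀ t, 0 ≤ θ t ∧ θ t ≤ 1 := fun t => by
    simp only [hθ]; split_ifs <;> norm_num
  set sj : ℕ → 𝔼 n → ℝ := fun j x => φ j x - (k x - s x) with hsj
  set Gj : ℕ → 𝔼 n → 𝔼 n := fun j x => gradient (φ j) x - (Gk x - Gs x) with hGj
  have hsjG : ∀ j, HasWeakGradient Ω (sj j) (Gj j) := fun j =>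
    (ContDiff.hasWeakGradient ((hφ j).1.of_le (by simp))).sub (hk.sub hs)
  have hpos := fun j => (hsjG j).posPart hΩ
  have hspos := hs.posPart hΩ
  have hkm := hk.1.aestronglyMeasurable
  have hsmeas := hs.1.aestronglyMeasurable
  have hGsmeas := hs.2.1.aestronglyMeasurable
  have hmod1 : ∀ j, modular p Ω (sj j) < ⊤ := fun j => by
    have e : sj j = fun x => s x - (k x - φ j x) := by funext x; simp only [hsj]; ring
    rw [e]
    exact (modular_sub_le hΩm hpc hp0 hsmeas).trans_lt (ENNReal.mul_lt_top ENNReal.ofReal_lt_top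
      (ENNReal.add_lt_top.2 ⟨hsm, (hφ1 j).trans_lt ENNReal.ofReal_lt_top⟩))
  have hmod2 : ∀ j, modular p Ω (Gj j) < ⊤ := fun j => by
    have e : Gj j = fun x => Gs x - (Gk x - gradient (φ j) x) := by
      funext x; simp only [hGj]; abel
    rw [e]
    exact (modular_sub_le hΩm hpc hp0 hGsmeas).trans_lt (ENNReal.mul_lt_top ENNReal.ofReal_lt_top
      (ENNReal.add_lt_top.2 ⟨hGsm, (hφ2 j).trans_lt ENNReal.ofReal_lt_top⟩))
  -- The only use of `s ≤ k`: where `φ j` vanishes, `sj j = s - k ≤ 0`, so its positive part has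
  -- compact support in `Ω`.
  have hout : ∀ j, ∀ x ∉ tsupport (φ j), sj j x ≤ 0 := fun j x hx => by
    simp only [hsj, IsTestFunction.eq_zero hx]
    linarith [hle x]
  have happ : ∀ j, ModularApprox p Ω (fun x => max (sj j x) 0)
      (fun x => θ (sj j x) • Gj j x) := fun j => by
    refine modularApprox_of_isCompact hΩ hp hpLip (hφ j).isCompact (hφ j).subset (hpos j)
      (fun x hx => max_eq_right (hout j x hx)) (fun x hx => ?_) ?_ ?_
    · simp [hθ, (hout j x hx).not_gt]
    · refine (modular_mono hΩm (fun x hx => (hp0 x hx).1) fun x _ => ?_).trans_lt (hmod1 j)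
      rw [Real.norm_of_nonneg (le_max_right _ _)]
      exact max_le (le_abs_self _) (abs_nonneg _)
    · refine (modular_mono hΩm (fun x hx => (hp0 x hx).1) fun x _ => ?_).trans_lt (hmod2 j)
      rw [norm_smul]
      refine mul_le_of_le_one_left (norm_nonneg _) ?_
      change ‖θ (sj j x)‖ ≤ 1
      rw [Real.norm_of_nonneg (hθ01 _).1]
      exact (hθ01 _).2
  have hae : ∀ᵐ x ∂volume.restrict Ω, Tendsto (fun j => sj j x) atTop (𝓝 (s x)) := by
    have h := ae_tendsto_of_tsum_modular_ne_top (f := fun j x => k x - φ j x) hΩm hpc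
      (fun x hx => by linarith [(hp x hx).1])
      (fun j => hkm.sub (hφ j).continuous.aestronglyMeasurable) (by
        refine ne_top_of_le_ne_top ?_ (ENNReal.tsum_le_tsum hφ1)
        exact (summable_geometric_of_lt_one (by norm_num) (by norm_num)).tsum_ofReal_ne_top)
    filter_upwards [h] with x hx
    have := hx.const_sub (s x)
    rw [sub_zero] at this
    refine this.congr fun j => ?_
    simp only [hsj]
    ring
  have hθm : ∀ j, AEStronglyMeasurable (fun x => θ (sj j x)) (volume.restrict Ω) := fun j => by
    have : Measurable θ := Measurable.ite measurableSet_Ioi measurable_const measurable_const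
    exact (this.comp_aemeasurable (hsjG j).1.aestronglyMeasurable.aemeasurable).aestronglyMeasurable
  have hθsm : AEStronglyMeasurable (fun x => θ (s x)) (volume.restrict Ω) := by
    have : Measurable θ := Measurable.ite measurableSet_Ioi measurable_const measurable_const
    exact (this.comp_aemeasurable hsmeas.aemeasurable).aestronglyMeasurable
  have hfirst : Tendsto (fun j => modular p Ω (fun x => (θ (s x) - θ (sj j x)) • Gs x)) atTop
      (𝓝 (∫⁻ _ in Ω, (0 : ℝ≥0∞))) := by
    refine tendsto_lintegral_of_dominated_convergence' (fun x => ENNReal.ofReal (‖Gs x‖ ^ p x))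
      (fun j => aemeasurable_ofReal_norm_rpow hΩm hpc ((hθsm.sub (hθm j)).smul hGsmeas))
      (fun j => ?_) hGsm.ne ?_
    · filter_upwards [ae_restrict_mem hΩm] with x hx
      refine ENNReal.ofReal_le_ofReal (Real.rpow_le_rpow (norm_nonneg _) ?_ (hp0 x hx).1)
      rw [norm_smul]
      refine mul_le_of_le_one_left (norm_nonneg _) ?_
      rw [Real.norm_eq_abs, abs_le]
      constructor <;> linarith [hθ01 (s x), hθ01 (sj j x)]
    · filter_upwards [hae, hs.ae_eq_zero_of_eq_zero hΩ, ae_restrict_mem hΩm] with x hx hx0 hxΩ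
      have hz : (0 : ℝ) ^ p x = 0 := Real.zero_rpow (by linarith [(hp x hxΩ).1])
      refine tendsto_const_nhds.congr' ?_
      rcases lt_trichotomy (s x) 0 with h | h | h
      · filter_upwards [hx.eventually_lt_const h] with j hj
        simp [hθ, h.not_gt, hj.not_gt, hz]
      · simp [hx0 h, hz]
      · filter_upwards [hx.eventually_const_lt h] with j hj
        simp [hθ, h, hj, hz]
  rw [lintegral_zero] at hfirst
  refine ModularApprox.of_forall_exists hΩm hpc hp0 hspos.1.aestronglyMeasurable
    hspos.2.1.aestronglyMeasurable fun ε hε => ?_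
  obtain ⟨δ, hδ, hδε⟩ := exists_two_rpow_mul_le pp hε
  have h1 := hfirst.eventually_le_const (ENNReal.ofReal_pos.2 hδ)
  have h2 := (tendsto_pow_atTop_nhds_zero_of_lt_one (r := (1 / 2 : ℝ)) (by norm_num)
    (by norm_num)).eventually_le_const (lt_min hδ hε)
  obtain ⟨j, hj1, hj2⟩ := (h1.and h2).exists
  refine ⟨_, _, happ j, (hpos j).1.aestronglyMeasurable, (hpos j).2.1.aestronglyMeasurable, ?_, ?_⟩
  · refine (modular_mono hΩm (fun x hx => (hp0 x hx).1) fun x _ => ?_).trans ((hφ1 j).trans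
      (ENNReal.ofReal_le_ofReal (hj2.trans (min_le_right _ _))))
    have e : k x - φ j x = s x - sj j x := by simp only [hsj]; ring
    rw [e, Real.norm_eq_abs, Real.norm_eq_abs]
    exact abs_max_sub_max_le_abs _ _ _
  · have e : (fun x => (if 0 < s x then (1 : ℝ) else 0) • Gs x - θ (sj j x) • Gj j x) = fun x =>
        (θ (s x) - θ (sj j x)) • Gs x + θ (sj j x) • (Gk x - gradient (φ j) x) := by
      funext x
      have : Gj j x = Gs x - (Gk x - gradient (φ j) x) := by simp only [hGj]; abel
      rw [this, sub_smul, smul_sub]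
      simp only [hθ]
      abel
    rw [e]
    refine (modular_add_le hΩm hpc hp0 ((hθsm.sub (hθm j)).smul hGsmeas)).trans
      (le_trans ?_ hδε)
    gcongr
    · exact hj1
    · refine (modular_mono hΩm (fun x hx => (hp0 x hx).1) fun x _ => ?_).trans ((hφ2 j).trans
        (ENNReal.ofReal_le_ofReal (hj2.trans (min_le_left _ _))))
      rw [norm_smul, Real.norm_of_nonneg (hθ01 _).1]
      exact mul_le_of_le_one_left (norm_nonneg _) (hθ01 _).2

end SobolevZero

/-! ### Monotonicity and integrability of the nonlinear terms. -/

section Comparison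

theorem rpow_sub_two_mul_self {a r : ℝ} (ha : 0 ≤ a) (hr : 1 < r) :
    a ^ (r - 2) * a = a ^ (r - 1) := by
  rcases ha.eq_or_lt with rfl | h
  · rw [mul_zero, Real.zero_rpow (by linarith)]
  · rw [← Real.rpow_add_one h.ne']
    congr 1
    ring

theorem rpow_sub_one_mul_le {a b r : ℝ} (ha : 0 ≤ a) (hb : 0 ≤ b) (hr : 1 < r) :
    a ^ (r - 1) * b ≤ a ^ r + b ^ r := by
  have key : ∀ {c : ℝ}, 0 ≤ c → c ^ (r - 1) * c = c ^ r := fun {c} hc => by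
    rw [← Real.rpow_add_one' hc (by linarith)]
    congr 1
    ring
  rcases le_total a b with h | h
  · calc a ^ (r - 1) * b ≤ b ^ (r - 1) * b := by gcongr
      _ = b ^ r := key hb
      _ ≤ a ^ r + b ^ r := le_add_of_nonneg_left (by positivity)
  · calc a ^ (r - 1) * b ≤ a ^ (r - 1) * a := by gcongr
      _ = a ^ r := key ha
      _ ≤ a ^ r + b ^ r := le_add_of_nonneg_right (by positivity)

/-- Monotonicity of `ξ ↦ |ξ|^{r-2} ξ`. -/
theorem norm_rpow_mul_inner_sub_le {F : Type*} [NormedAddCommGroup F] [InnerProductSpace ℝ F]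
    {r : ℝ} (hr : 1 < r) (ξ η : F) :
    ‖η‖ ^ (r - 2) * inner ℝ η (ξ - η) ≤ ‖ξ‖ ^ (r - 2) * inner ℝ ξ (ξ - η) := by
  have hCS := real_inner_le_norm ξ η
  have ha := rpow_sub_two_mul_self (norm_nonneg ξ) hr
  have hb := rpow_sub_two_mul_self (norm_nonneg η) hr
  -- The difference of the two sides equals this product plus `(‖ξ‖ ^ (r - 2) + ‖η‖ ^ (r - 2)) *
  -- (‖ξ‖ * ‖η‖ - ⟨ξ, η⟩)`, whose last factor is nonnegative by Cauchy–Schwarz.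
  have hab : 0 ≤ (‖ξ‖ - ‖η‖) * (‖ξ‖ ^ (r - 1) - ‖η‖ ^ (r - 1)) := by
    rcases le_total ‖ξ‖ ‖η‖ with h | h
    · exact mul_nonneg_of_nonpos_of_nonpos (by linarith)
        (by linarith [Real.rpow_le_rpow (norm_nonneg _) h (by linarith : 0 ≤ r - 1)])
    · exact mul_nonneg (by linarith)
        (by linarith [Real.rpow_le_rpow (norm_nonneg _) h (by linarith : 0 ≤ r - 1)])
  rw [← ha, ← hb] at hab
  rw [inner_sub_right, inner_sub_right, real_inner_self_eq_norm_sq, real_inner_self_eq_norm_sq,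
    real_inner_comm ξ η]
  have h1 : 0 ≤ ‖ξ‖ ^ (r - 2) * (‖ξ‖ * ‖η‖ - inner ℝ ξ η) :=
    mul_nonneg (by positivity) (by linarith)
  have h2 : 0 ≤ ‖η‖ ^ (r - 2) * (‖ξ‖ * ‖η‖ - inner ℝ ξ η) :=
    mul_nonneg (by positivity) (by linarith)
  nlinarith

theorem abs_rpow_mul_self_strictMono {r : ℝ} (hr : 1 < r) :
    StrictMono fun t : ℝ => |t| ^ (r - 2) * t := by
  have hr' : 0 < r - 1 := by linarith
  have hnn : ∀ {t : ℝ}, 0 ≤ t → |t| ^ (r - 2) * t = t ^ (r - 1) := fun {t} ht => by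
    rw [abs_of_nonneg ht, rpow_sub_two_mul_self ht hr]
  have hnp : ∀ {t : ℝ}, t ≤ 0 → |t| ^ (r - 2) * t = -(-t) ^ (r - 1) := fun {t} ht => by
    rw [abs_of_nonpos ht, ← rpow_sub_two_mul_self (neg_nonneg.2 ht) hr]
    ring
  intro s t hst
  simp only
  rcases le_total 0 s with hs | hs
  · rw [hnn hs, hnn (hs.trans hst.le)]
    exact Real.rpow_lt_rpow hs hst hr'
  · rcases le_or_gt t 0 with ht | ht
    · rw [hnp hs, hnp ht]
      exact neg_lt_neg (Real.rpow_lt_rpow (by linarith) (by linarith) hr')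
    · rw [hnp hs, hnn ht.le]
      have h1 : 0 < t ^ (r - 1) := by positivity
      have h2 : 0 ≤ (-s) ^ (r - 1) := Real.rpow_nonneg (by linarith) _
      linarith

variable {n : ℕ} {p : 𝔼 n → ℝ} {Ω : Set (𝔼 n)}

theorem integrableOn_norm_rpow_mul_inner {F : Type*} [NormedAddCommGroup F]
    [InnerProductSpace ℝ F] (hΩ : MeasurableSet Ω) (hpc : ContinuousOn p Ω)
    (hp : ∀ x ∈ Ω, 1 < p x) {f g : 𝔼 n → F}
    (hf : AEStronglyMeasurable f (volume.restrict Ω)) (hfm : modular p Ω f < ⊤)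
    (hg : AEStronglyMeasurable g (volume.restrict Ω)) (hgm : modular p Ω g < ⊤) :
    IntegrableOn (fun x => ‖f x‖ ^ (p x - 2) * inner ℝ (f x) (g x)) Ω := by
  refine Integrable.mono' ((integrableOn_norm_rpow hΩ hpc hf hfm).add
    (integrableOn_norm_rpow hΩ hpc hg hgm)) ?_ ?_
  · exact (hf.norm.aemeasurable.pow
      ((hpc.aemeasurable hΩ).sub_const 2)).aestronglyMeasurable.mul (hf.inner hg)
  · filter_upwards [ae_restrict_mem hΩ] with x hx
    rw [norm_mul, Real.norm_of_nonneg (by positivity)]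
    calc ‖f x‖ ^ (p x - 2) * ‖inner ℝ (f x) (g x)‖
        ≤ ‖f x‖ ^ (p x - 2) * (‖f x‖ * ‖g x‖) := by
          gcongr; exact norm_inner_le_norm _ _
      _ = ‖f x‖ ^ (p x - 1) * ‖g x‖ := by
        rw [← mul_assoc, rpow_sub_two_mul_self (norm_nonneg _) (hp x hx)]
      _ ≤ _ := rpow_sub_one_mul_le (norm_nonneg _) (norm_nonneg _) (hp x hx)

theorem integrableOn_mul_of_conjugate (hΩ : MeasurableSet Ω) (hpc : ContinuousOn p Ω)
    (hp : ∀ x ∈ Ω, 1 < p x) {f g : 𝔼 n → ℝ}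
    (hf : AEStronglyMeasurable f (volume.restrict Ω))
    (hfm : modular (fun x => p x / (p x - 1)) Ω f < ⊤)
    (hg : AEStronglyMeasurable g (volume.restrict Ω)) (hgm : modular p Ω g < ⊤) :
    IntegrableOn (fun x => f x * g x) Ω := by
  have hqc : ContinuousOn (fun x => p x / (p x - 1)) Ω :=
    hpc.div (hpc.sub continuousOn_const) fun x hx => by linarith [hp x hx]
  refine Integrable.mono' ((integrableOn_norm_rpow hΩ hqc hf hfm).add
    (integrableOn_norm_rpow hΩ hpc hg hgm)) (hf.mul hg) ?_
  filter_upwards [ae_restrict_mem hΩ] with x hx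
  have h1 : Real.HolderConjugate (p x / (p x - 1)) (p x) :=
    (Real.HolderConjugate.conjExponent (hp x hx)).symm
  rw [norm_mul]
  refine (Real.young_inequality_of_nonneg (norm_nonneg (f x)) (norm_nonneg (g x)) h1).trans ?_
  exact add_le_add (div_le_self (by positivity) h1.lt.le)
    (div_le_self (by positivity) (hp x hx).le)

end Comparison

/-! ### The comparison principle. -/

theorem mainTheorem9 {n : ℕ} {Ω : Set (EuclideanSpace ℝ (Fin n))} (hΩ : IsOpen Ω)
    {p : EuclideanSpace ℝ (Fin n) → ℝ} {pm pp : ℝ} (hpm : 1 < pm)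
    (hp : ∀ x ∈ Ω, pm ≤ p x ∧ p x ≤ pp) (hpLip : ∃ K, LipschitzOnWith K p Ω)
    {a : ℝ} (ha : a < 0)
    {f f' g g' u v : EuclideanSpace ℝ (Fin n) → ℝ}
    (hf : MemLpVar (fun x => p x / (p x - 1)) Ω f)
    (hf' : MemLpVar (fun x => p x / (p x - 1)) Ω f')
    (hff' : ∀ᵐ x ∂(volume.restrict Ω), f x ≤ f' x)
    (hg : MemSobolev p Ω g) (hg' : MemSobolev p Ω g')
    (hgg' : LeOnBoundary p Ω g g')
    (hu : IsWeakSolution p Ω a f u) (hug : EqOnBoundary p Ω u g)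
    (hv : IsWeakSolution p Ω a f' v) (hvg' : EqOnBoundary p Ω v g') :
    ∀ᵐ x ∂(volume.restrict Ω), u x ≤ v x := by
  have hpc : ContinuousOn p Ω := hpLip.choose_spec.continuousOn
  have hΩm := hΩ.measurableSet
  have hp1 : ∀ x ∈ Ω, 1 < p x := fun x hx => hpm.trans_le (hp x hx).1
  have hp1' : ∀ x ∈ Ω, 1 ≤ p x ∧ p x ≤ pp := fun x hx => ⟨(hp1 x hx).le, (hp x hx).2⟩
  have hp0 : ∀ x ∈ Ω, 0 ≤ p x ∧ p x ≤ pp := fun x hx =>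
    ⟨by linarith [hp1 x hx], (hp x hx).2⟩
  obtain ⟨⟨⟨hum, hul⟩, Gu, hGu, hGum, hGul⟩, hueq⟩ := hu
  obtain ⟨⟨⟨hvm, hvl⟩, Gv, hGv, hGvm, hGvl⟩, hveq⟩ := hv
  obtain ⟨⟨h1m, -⟩, G1, hG1, ⟨hG1m, -⟩, ha1⟩ := hug
  obtain ⟨-, G2, hG2, -, ha2⟩ := hvg'
  obtain ⟨-, G3, hG3, -, ha3⟩ := hgg'
  have hb1 := modularApprox_of_luxNorm hΩm (fun x hx => (hp1 x hx).le) ha1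
  have hb2 := modularApprox_of_luxNorm hΩm (fun x hx => (hp1 x hx).le) ha2
  have hb3 := modularApprox_of_luxNorm hΩm (fun x hx => (hp1 x hx).le) ha3
  have hul' := modular_lt_top_of_luxNorm_lt_top hΩm hp0 hul
  have hvl' := modular_lt_top_of_luxNorm_lt_top hΩm hp0 hvl
  have hGul' := modular_lt_top_of_luxNorm_lt_top hΩm hp0 hGul
  have hGvl' := modular_lt_top_of_luxNorm_lt_top hΩm hp0 hGvl
  have hq : ∀ x ∈ Ω, 0 ≤ p x / (p x - 1) ∧ p x / (p x - 1) ≤ pm / (pm - 1) := by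
    intro x hx
    have h1 := hp1 x hx
    refine ⟨div_nonneg (by linarith) (by linarith), ?_⟩
    rw [div_le_div_iff₀ (by linarith) (by linarith)]
    linarith [(hp x hx).1]
  have hfl' := modular_lt_top_of_luxNorm_lt_top hΩm hq hf.2
  have hfl'' := modular_lt_top_of_luxNorm_lt_top hΩm hq hf'.2
  have hs := hGu.sub hGv
  have hsm : modular p Ω (fun x => u x - v x) < ⊤ :=
    (modular_sub_le hΩm hpc hp0 hum).trans_lt (ENNReal.mul_lt_top ENNReal.ofReal_lt_top
      (ENNReal.add_lt_top.2 ⟨hul', hvl'⟩))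
  have hGsm : modular p Ω (fun x => Gu x - Gv x) < ⊤ :=
    (modular_sub_le hΩm hpc hp0 hGum).trans_lt (ENNReal.mul_lt_top ENNReal.ofReal_lt_top
      (ENNReal.add_lt_top.2 ⟨hGul', hGvl'⟩))
  have hw := hs.posPart hΩ
  have h12 := hG1.add hG2.neg
  -- The dominating function is `(u - g) - (v - g') + (g - g')⁺`; it is at least `u - v` because `g
  -- - g' ≤ (g - g')⁺`.
  have hwa := ModularApprox.posPart_of_le hΩ hp1' hpLip (h12.add hG3)
    (ModularApprox.add hΩm hpc hp0 h12.1.aestronglyMeasurable h12.2.1.aestronglyMeasurable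
      (ModularApprox.add hΩm hpc hp0 h1m hG1m hb1 hb2.neg) hb3) hs hsm hGsm
    (fun x => by linarith [le_max_left (g x - g' x) 0])
  set w : 𝔼 n → ℝ := fun x => max (u x - v x) 0 with hwdef
  set H : 𝔼 n → 𝔼 n := fun x => (if 0 < u x - v x then (1 : ℝ) else 0) • (Gu x - Gv x) with hHdef
  have hwm : modular p Ω w < ⊤ := by
    refine (modular_mono hΩm (fun x hx => (hp0 x hx).1) fun x _ => ?_).trans_lt hsm
    rw [Real.norm_of_nonneg (le_max_right _ _)]
    exact max_le (le_abs_self _) (abs_nonneg _)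
  have hHm : modular p Ω H < ⊤ := by
    refine (modular_mono hΩm (fun x hx => (hp0 x hx).1) fun x _ => ?_).trans_lt hGsm
    simp only [hHdef]
    split_ifs <;> simp
  have hwmeas := hw.1.aestronglyMeasurable
  have hHmeas := hw.2.1.aestronglyMeasurable
  have hw0 : MemSobolevZero p Ω w :=
    ⟨⟨hwmeas, luxNorm_lt_top_of_modular_lt_top hΩm (fun x hx => (hp1 x hx).le) hwm⟩, H, hw,
      ⟨hHmeas, luxNorm_lt_top_of_modular_lt_top hΩm (fun x hx => (hp1 x hx).le) hHm⟩,
      hwa.luxNorm hΩm fun x hx => (hp x hx).2⟩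
  have E1 := hueq Gu hGu w H hw0 hw
  have E2 := hveq Gv hGv w H hw0 hw
  -- A nonintegrable function has integral `0` by convention, so integrability is needed before
  -- integrals can be compared or subtracted.
  have i1 := integrableOn_norm_rpow_mul_inner hΩm hpc hp1 hGum hGul' hHmeas hHm
  have i2 := integrableOn_norm_rpow_mul_inner hΩm hpc hp1 hGvm hGvl' hHmeas hHm
  have i3 : IntegrableOn (fun x => |u x| ^ (p x - 2) * u x * w x) Ω := by
    refine (integrableOn_norm_rpow_mul_inner hΩm hpc hp1 hum hul' hwmeas hwm).congr
      (Eventually.of_forall fun x => ?_)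
    simp [mul_assoc, mul_comm (w x)]
  have i4 : IntegrableOn (fun x => |v x| ^ (p x - 2) * v x * w x) Ω := by
    refine (integrableOn_norm_rpow_mul_inner hΩm hpc hp1 hvm hvl' hwmeas hwm).congr
      (Eventually.of_forall fun x => ?_)
    simp [mul_assoc, mul_comm (w x)]
  have i5 := integrableOn_mul_of_conjugate hΩm hpc hp1 hf.1 hfl' hwmeas hwm
  have i6 := integrableOn_mul_of_conjugate hΩm hpc hp1 hf'.1 hfl'' hwmeas hwm
  have hL : ∫ x in Ω, ‖Gv x‖ ^ (p x - 2) * inner ℝ (Gv x) (H x) ≤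
      ∫ x in Ω, ‖Gu x‖ ^ (p x - 2) * inner ℝ (Gu x) (H x) := by
    refine setIntegral_mono_on i2 i1 hΩm fun x hx => ?_
    simp only [hHdef]
    split_ifs
    · simpa using norm_rpow_mul_inner_sub_le (hp1 x hx) (Gu x) (Gv x)
    · simp
  have hR : ∫ x in Ω, f x * w x ≤ ∫ x in Ω, f' x * w x := by
    refine integral_mono_ae i5 i6 ?_
    filter_upwards [hff'] with x hx
    exact mul_le_mul_of_nonneg_right hx (le_max_right _ _)
  have hD0 : 0 ≤ᵐ[volume.restrict Ω] fun x =>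
      |u x| ^ (p x - 2) * u x * w x - |v x| ^ (p x - 2) * v x * w x := by
    filter_upwards [ae_restrict_mem hΩm] with x hx
    rw [← sub_mul]
    rcases le_or_gt (u x) (v x) with h | h
    · simp [hwdef, h]
    · exact mul_nonneg (sub_nonneg.2 ((abs_rpow_mul_self_strictMono (hp1 x hx)).monotone h.le))
        (le_max_right _ _)
  have hDint : ∫ x in Ω, (|u x| ^ (p x - 2) * u x * w x - |v x| ^ (p x - 2) * v x * w x) = 0 := by
    refine le_antisymm ?_ (integral_nonneg_of_ae hD0)
    rw [integral_sub i3 i4]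
    -- Subtracting `E2` from `E1` and using `hL` and `hR` shows that `a` times the difference of the
    -- two integrals is nonnegative; `a < 0` reverses the sign.
    nlinarith
  have hDae := (integral_eq_zero_iff_of_nonneg_ae hD0 (i3.sub i4)).1 hDint
  filter_upwards [hDae, ae_restrict_mem hΩm] with x hx hxΩ
  by_contra! h
  have hlt := abs_rpow_mul_self_strictMono (hp1 x hxΩ) h
  have hwpos : 0 < w x := lt_max_of_lt_left (sub_pos.2 h)
  rw [← sub_mul] at hx
  exact (mul_pos (sub_pos.2 hlt) hwpos).ne' hx
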